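/- **Problem.** Let $F(x)=\mathbb E_\zeta[f(x,\zeta)]$ and $h_k(x)=\mathbb E_{\xi}[h_k(x,\xi)]$, $k=1,\dots,m$, be functions on $\mathbb R^d$, where the law of $\xi$ may depend on $k$, and for a penalty parameter $\beta>0$ put $\Phi(x)=F(x)+\frac{\beta}{m}\sum_{k=1}^m[h_k(x)]_+$ with $[z]_+=\max\{0,z\}$. Write $\partial\psi(x)=\{v:\psi(y)\ge\psi(x)+\langle v,y-x\rangle+o(\|y-x\|),\ y\to x\}$, and call $\psi$ $\rho$-weakly convex if $\psi(x)\ge\psi(x')+\langle v,x-x'\rangle-\frac{\rho}{2}\|x-x'\|^2$ for all $x,x'$ and all $v\in\partial\psi(x')$. **Assumptions.** $F$ is $\rho_0$-weakly convex and $L_F$-Lipschitz; every $h_k$ is $\rho_1$-weakly convex and $L_h$-Lipschitz ($\rho_0,\rho_1>0$). There are stochastic subgradients $\partial f(x,\zeta)$, $\partial h_k(x,\xi)$, which for each $x$ almost surely are subgradients at $x$ of $f(\cdot,\zeta)$, $h_k(\cdot,\xi)$, such that $\mathbb E[\partial f(x,\zeta)]\in\partial F(x)$, $\mathbb E[\partial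 h_k(x,\xi)]\in\partial h_k(x)$, $\mathbb E|h_k(x,\xi)-h_k(y,\xi)|^2\le L_h^2\|x-y\|^2$, $\mathbb E|h_k(x,\xi)-h_k(x)|^2\le\sigma_h^2$, and $\mathbb E\|\partial f(x,\zeta)-\mathbb E[\partial f(x,\zeta)]\|^2\le\sigma_f^2$, for all $x,y,k$. **Algorithm.** Start from $x_{-1}=x_0\in\mathbb R^d$ and $u^0\in\mathbb R^m$. At $t=0,1,\dots,T-1$ draw, independently of each other and of the past, a uniformly random set $\mathcal B_c^t\subset\{1,\dots,m\}$ of size $|\mathcal B_c|\ge 1$, for every $k\in\mathcal B_c^t$ a mini-batch $\mathcal B_{2,k}^t$ of $|\mathcal B_2|\ge 1$ i.i.d. samples of $\xi$, and a nonempty mini-batch $\mathcal B^t$ of i.i.d. samples of $\zeta$ of fixed size. A mini-batch as an argument means the average over it. Put, with $[u]'_+\in\partial[\cdot]_+(u)$ and $\gamma_2'=\frac{m-|\mathcal B_c|}{|\mathcal B_c|(1-\gamma_2)}+1-\gamma_2$, $$G_1^t=\partial f(x_t;\mathcal B^t),\qquad G_2^t=\frac{\beta}{|\mathcal B_c|}\sum_{k\in\mathcal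 B_c^t}[u_k^t]'_+\,\partial h_k(x_t;\mathcal B_{2,k}^t),\qquad x_{t+1}=x_t-\eta(G_1^t+G_2^t),$$ $$u_k^{t+1}=(1-\gamma_2)u_k^t+\gamma_2h_k(x_t;\mathcal B_{2,k}^t)+\gamma_2'\big(h_k(x_t;\mathcal B_{2,k}^t)-h_k(x_{t-1};\mathcal B_{2,k}^t)\big)\ \ (k\in\mathcal B_c^t),\qquad u_k^{t+1}=u_k^t\ \ (k\notin\mathcal B_c^t).$$ **Theorem.** For all $d,\rho_0,\rho_1,L_F,L_h,\sigma_f,\sigma_h$, all $\beta_0>0$ and all $\Delta,\Delta_u$ there are constants $c_1\in(0,\frac12]$ and $c_2,c_3>0$, depending only on these quantities, with the following property. Let the assumptions hold, let $\beta\ge\beta_0$, $\varepsilon>0$, $\Phi(x_0)-\inf\Phi\le\Delta\beta$, $\frac1m\sum_k|u_k^0-h_k(x_0)|\le\Delta_u$, and run the algorithm with $$\gamma_2=c_1\frac{|\mathcal B_2|\varepsilon^4}{\beta^4},\qquad \eta=c_2\frac{|\mathcal B_c||\mathcal B_2|^{1/2}\varepsilon^4}{\beta^5m},\qquad T\ge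 c_3\frac{\beta^6m}{|\mathcal B_c||\mathcal B_2|^{1/2}\varepsilon^6},$$ where $\gamma_2\le\frac12$ (true in particular if $|\mathcal B_2|\varepsilon^4\le\beta^4$). Let $\theta=\frac{1}{2(\rho_0+\rho_1\beta)}$ and $\Phi_\theta(x)=\min_y\{\Phi(y)+\frac1{2\theta}\|y-x\|^2\}$, and let $\hat t$ be uniform on $\{1,\dots,T\}$ and independent of the samples. Then $\Phi_\theta$ is differentiable and $$\mathbb E\|\nabla\Phi_\theta(x_{\hat t})\|\le\varepsilon .$$ In particular $T=O\big(\frac{\beta^6m}{|\mathcal B_c||\mathcal B_2|^{1/2}\varepsilon^6}\big)$, i.e. $O(\varepsilon^{-6})$, iterations suffice. -/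

import Mathlib

open MeasureTheory ProbabilityTheory
open scoped NNReal Gradient

namespace HingePenalty

noncomputable section

/-- `ℝ^d` with the Euclidean norm. -/
abbrev E (d : ℕ) : Type := EuclideanSpace ℝ (Fin d)

/-- `v` is a (Fréchet) subgradient of `ψ` at `x`:
`ψ y ≥ ψ x + ⟨v, y - x⟩ + o(‖y - x‖)` as `y → x`. -/
def IsSubgrad {V : Type*} [NormedAddCommGroup V] [InnerProductSpace ℝ V]
    (ψ : V → ℝ) (x v : V) : Prop :=
  ∀ c : ℝ, 0 < c → ∀ᶠ y in nhds x, ψ x + inner ℝ v (y - x) - c * ‖y - x‖ ≤ ψ y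

/-- `ψ` is `ρ`-weakly convex: the quadratically relaxed subgradient inequality holds for
every subgradient at every point. -/
def WeaklyConvex {V : Type*} [NormedAddCommGroup V] [InnerProductSpace ℝ V]
    (ρ : ℝ) (ψ : V → ℝ) : Prop :=
  ∀ x x' v : V, IsSubgrad ψ x' v →
    ψ x' + inner ℝ v (x - x') - ρ / 2 * ‖x - x'‖ ^ 2 ≤ ψ x

/-- The Moreau envelope `ψ_θ(x) = min_y ψ(y) + ‖y - x‖² / (2θ)`. -/
def moreauEnv {V : Type*} [NormedAddCommGroup V] (θ : ℝ) (ψ : V → ℝ) (x : V) : ℝ :=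
  ⨅ y : V, ψ y + 1 / (2 * θ) * ‖y - x‖ ^ 2

/-- The hinge function `[z]_+ = max {0, z}`. -/
def hinge (z : ℝ) : ℝ := max 0 z

/-- `E ‖X‖² ≤ c`, the second moment being finite. -/
def SecondMomentLE {α V : Type*} [MeasurableSpace α] [NormedAddCommGroup V]
    (μ : Measure α) (X : α → V) (c : ℝ) : Prop :=
  Integrable (fun a => ‖X a‖ ^ 2) μ ∧ ∫ a, ‖X a‖ ^ 2 ∂μ ≤ c

/-- The data of a stochastic problem with `m` constraints in `ℝ^d`: the sampled objective
`f(x, ζ)`, the sampled constraint functions `h_k(x, ξ)`, the stochastic subgradients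
`∂f(x, ζ)` and `∂h_k(x, ξ)` that the oracles return, and the laws of `ζ` and `ξ`
(the latter may depend on `k`). -/
structure Problem (d m : ℕ) (Z Ξ : Type*) [MeasurableSpace Z] [MeasurableSpace Ξ] where
  f : E d → Z → ℝ
  df : E d → Z → E d
  h : Fin m → E d → Ξ → ℝ
  dh : Fin m → E d → Ξ → E d
  lawZ : Measure Z
  lawΞ : Fin m → Measure Ξ

section

variable {d m : ℕ} {Z Ξ : Type*} [MeasurableSpace Z] [MeasurableSpace Ξ]

/-- The objective `F(x) = E f(x, ζ)`. -/
def Problem.F (p : Problem d m Z Ξ) (x : E d) : ℝ := ∫ ζ, p.f x ζ ∂p.lawZ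

/-- The constraint function `h_k(x) = E h_k(x, ξ)`. -/
def Problem.H (p : Problem d m Z Ξ) (k : Fin m) (x : E d) : ℝ := ∫ ξ, p.h k x ξ ∂p.lawΞ k

/-- The hinge penalty function `Φ(x) = F(x) + (β / m) ∑_k [h_k(x)]_+`. -/
def Problem.Phi (p : Problem d m Z Ξ) (β : ℝ) (x : E d) : ℝ :=
  p.F x + β / m * ∑ k, hinge (p.H k x)

/-- The standing assumptions on the objective, the constraints and the stochastic oracles. -/
structure Problem.Assumptions (p : Problem d m Z Ξ)
    (ρ₀ ρ₁ : ℝ) (L_F L_h : ℝ≥0) (σ_f σ_h : ℝ) : Prop where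
  probZ : IsProbabilityMeasure p.lawZ
  probΞ : ∀ k, IsProbabilityMeasure (p.lawΞ k)
  measurable_df : Measurable (Function.uncurry p.df)
  measurable_h : ∀ k, Measurable (Function.uncurry (p.h k))
  measurable_dh : ∀ k, Measurable (Function.uncurry (p.dh k))
  -- the objective and the constraints are weakly convex and Lipschitz continuous
  weaklyConvex_F : WeaklyConvex ρ₀ p.F
  lipschitz_F : LipschitzWith L_F p.F
  weaklyConvex_H : ∀ k, WeaklyConvex ρ₁ (p.H k)
  lipschitz_H : ∀ k, LipschitzWith L_h (p.H k)
  -- stochastic constraint oracle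
  integrable_h : ∀ k x, Integrable (p.h k x) (p.lawΞ k)
  subgrad_h : ∀ k x, ∀ᵐ ξ ∂p.lawΞ k, IsSubgrad (fun y => p.h k y ξ) x (p.dh k x ξ)
  integrable_dh : ∀ k x, Integrable (p.dh k x) (p.lawΞ k)
  mean_dh : ∀ k x, IsSubgrad (p.H k) x (∫ ξ, p.dh k x ξ ∂p.lawΞ k)
  meanSquareLipschitz_h : ∀ k x y,
    SecondMomentLE (p.lawΞ k) (fun ξ => p.h k x ξ - p.h k y ξ) (L_h ^ 2 * ‖x - y‖ ^ 2)
  variance_h : ∀ k x, SecondMomentLE (p.lawΞ k) (fun ξ => p.h k x ξ - p.H k x) (σ_h ^ 2)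
  -- stochastic objective oracle
  integrable_f : ∀ x, Integrable (p.f x) p.lawZ
  subgrad_f : ∀ x, ∀ᵐ ζ ∂p.lawZ, IsSubgrad (fun y => p.f y ζ) x (p.df x ζ)
  integrable_df : ∀ x, Integrable (p.df x) p.lawZ
  mean_df : ∀ x, IsSubgrad p.F x (∫ ζ, p.df x ζ ∂p.lawZ)
  variance_df : ∀ x,
    SecondMomentLE p.lawZ (fun ζ => p.df x ζ - ∫ ζ', p.df x ζ' ∂p.lawZ) (σ_f ^ 2)

/-- All samples drawn in one iteration: the set `B_c` of constraint indices, for every `k` a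
mini-batch `B_{2,k}` of `b₂` samples of `ξ`, and a mini-batch `B` of `b` samples of `ζ`.
The algorithm reads the mini-batch `B_{2,k}` only if `k ∈ B_c`. -/
abbrev Sample (m b₂ b : ℕ) (Z Ξ : Type*) : Type _ :=
  Finset (Fin m) × (Fin m → Fin b₂ → Ξ) × (Fin b → Z)

/-- The law of the samples of one iteration: `B_c` is uniform among the index sets of size
`bc`, the mini-batches consist of independent samples, and all of them are independent. -/
def Problem.sampleLaw (p : Problem d m Z Ξ) (bc b₂ b : ℕ) : Measure (Sample m b₂ b Z Ξ) :=
  (uniformOn {B : Finset (Fin m) | B.card = bc}).prod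
    ((Measure.pi fun k => Measure.pi fun _ : Fin b₂ => p.lawΞ k).prod
      (Measure.pi fun _ : Fin b => p.lawZ))

/-- Parameters of the algorithm: penalty parameter, the numbers `γ₂` and `η`, the size `bc` of
the sampled index sets, and the chosen subgradient `[u]'_+` of the hinge function at `u`. -/
structure Params where
  β : ℝ
  γ : ℝ
  η : ℝ
  bc : ℕ
  hinge' : ℝ → ℝ

/-- The parameter `γ₂' = (m - |B_c|) / (|B_c| (1 - γ₂)) + 1 - γ₂`. -/
def Params.γ' (a : Params) (m : ℕ) : ℝ :=
  ((m : ℝ) - a.bc) / (a.bc * (1 - a.γ)) + 1 - a.γ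

/-- State of the algorithm: current iterate `x_t`, previous iterate `x_{t-1}`, and the
estimators `u_{2,k}^t`. -/
structure State (d m : ℕ) where
  x : E d
  xprev : E d
  u : Fin m → ℝ

/-- Mini-batch average of a sampled quantity. -/
def batchMean {V α : Type*} [AddCommGroup V] [Module ℝ V] {b : ℕ}
    (g : α → V) (B : Fin b → α) : V :=
  (b : ℝ)⁻¹ • ∑ j, g (B j)

/-- One iteration: SGD step with `G_1^t + G_2^t`, and MSVR update of the estimators. -/
def Problem.step (p : Problem d m Z Ξ) (a : Params) {b₂ b : ℕ}
    (s : State d m) (w : Sample m b₂ b Z Ξ) : State d m :=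
  let Bc := w.1
  let B₂ := w.2.1
  let B := w.2.2
  let G₁ : E d := batchMean (p.df s.x) B
  let G₂ : E d :=
    (a.β / a.bc) • ∑ k ∈ Bc, a.hinge' (s.u k) • batchMean (p.dh k s.x) (B₂ k)
  { x := s.x - a.η • (G₁ + G₂)
    xprev := s.x
    u := fun k =>
      if k ∈ Bc then
        (1 - a.γ) * s.u k + a.γ * batchMean (p.h k s.x) (B₂ k)
          + a.γ' m * (batchMean (p.h k s.x) (B₂ k) - batchMean (p.h k s.xprev) (B₂ k))
      else s.u k }

/-- The state after `t` iterations from `x_0` and `u^0`, as a function of the samples `w t`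
drawn in the iterations `t = 0, 1, …`. The convention for the first iteration is
`x_{-1} = x_0`. -/
def Problem.run (p : Problem d m Z Ξ) (a : Params) (x₀ : E d) (u₀ : Fin m → ℝ) {b₂ b : ℕ}
    (w : ℕ → Sample m b₂ b Z Ξ) : ℕ → State d m
  | 0 => ⟨x₀, x₀, u₀⟩
  | t + 1 => p.step a (p.run a x₀ u₀ w t) (w t)

end

end

end HingePenalty

open HingePenalty

/-!
The penalty function `Φ` is `ρ`-weakly convex with `ρ = ρ₀ + ρ₁ β` and Lipschitz, so for step size
`1 / (2ρ)` its proximal points exist, depend on the base point in a Lipschitz way, and the Moreau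
envelope is differentiable with gradient `2ρ (x - q)`, `q` the proximal point of `x`
(`IsProx.hasGradientAt`). The envelope serves as the Lyapunov function of the iteration. Given the
past, the update direction `G₁ + G₂` is in mean a subgradient of `Φ`, except that the hinge function is
differentiated at the estimate `u_k` and not at `h_k(x)`; by convexity this costs at most
`2 |u_k - h_k(x)|` per constraint (`IsSubgrad.mul_sub_le`). One iteration therefore decreases the
envelope by `η ‖∇Φ_θ‖² / 4`, up to `4 ρ η β` times the estimation error averaged over `k` and up
to `ρ η²` times the second moment of the direction (`Problem.Assumptions.moreauEnv_step`). This second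
moment is `O(β²)`: no variance of `∂h_k(x, ξ)` is assumed, but Fatou's lemma applied to difference
quotients extracts a bound, with a factor `2d`, from the mean square Lipschitz condition
(`Problem.Assumptions.secondMoment_dh`).

The estimation error is controlled for each constraint separately. The value of `γ₂'` is the one
for which the drift `h_k(x_t) - h_k(x_{t-1})` has no cross term with the current error after
averaging over whether `k` is sampled. With `q = |B_c| / m`, the mean square error then contracts
by the factor `1 - q γ₂`, up to terms of order `‖x_t - x_{t-1}‖² / q` and `q γ₂² / |B_2|`
(`Problem.Assumptions.secondMoment_estimator_step`). The initial error is controlled only in mean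
absolute value over `k`; taking square roots constraint by constraint keeps it linear, and it then
decays geometrically and contributes a summable term
(`Problem.Assumptions.expectation_abs_error`).

Summing the descent inequality over the iterations leaves four terms, the initial suboptimality,
the initial estimation error, the noise floor of the estimators and the variance of the direction.
In the variables `q`, `S = √|B_2|` and `τ = ε² / β²` the step sizes are
`γ₂ = δ² S² τ² / 2` and `η = δ² q S τ² / β`, and a small `δ` makes each term at most a quarter of
`T ε²` (`total_error_le`); the condition `γ₂ ≤ 1/2` enters as `δ S τ ≤ 1`.
-/

namespace HingePenalty

/-! ### Subgradients -/

section Subgradient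

variable {V : Type*} [NormedAddCommGroup V] [InnerProductSpace ℝ V]

/-- A subgradient bounds difference quotients from below, up to an arbitrarily small error. -/
lemma IsSubgrad.eventually_sub_le_slope {ψ : V → ℝ} {x v : V} (h : IsSubgrad ψ x v) {e : V}
    (he : ‖e‖ = 1) {c : ℝ} (hc : 0 < c) :
    ∀ᶠ s in nhdsWithin (0 : ℝ) (Set.Ioi 0), inner ℝ v e - c ≤ (ψ (x + s • e) - ψ x) / s := by
  have ht : Filter.Tendsto (fun s : ℝ => x + s • e) (nhdsWithin 0 (Set.Ioi 0)) (nhds x) := by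
    have : Continuous (fun s : ℝ => x + s • e) := by fun_prop
    simpa using (this.tendsto 0).mono_left nhdsWithin_le_nhds
  filter_upwards [ht.eventually (h c hc), self_mem_nhdsWithin] with s hs hs0
  have hs0 : 0 < s := hs0
  rw [le_div_iff₀ hs0]
  simp only [add_sub_cancel_left, inner_smul_right, norm_smul, he, Real.norm_eq_abs,
    abs_of_pos hs0] at hs
  linarith

/-- Subgradients of an `L`-Lipschitz function are bounded by `L`. -/
lemma IsSubgrad.norm_le {ψ : V → ℝ} {x v : V} {L : ℝ≥0} (h : IsSubgrad ψ x v)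
    (hL : LipschitzWith L ψ) : ‖v‖ ≤ L := by
  by_cases hv : v = 0
  · simp [hv]
  have hv' : 0 < ‖v‖ := norm_pos_iff.mpr hv
  have he : ‖(‖v‖⁻¹ • v : V)‖ = 1 := by
    rw [norm_smul, norm_inv, norm_norm, inv_mul_cancel₀ hv'.ne']
  refine le_of_forall_pos_le_add fun c hc => ?_
  obtain ⟨s, hs, hs0⟩ := ((h.eventually_sub_le_slope he hc).and self_mem_nhdsWithin).exists
  have hs0 : 0 < s := hs0
  have h1 := hL.norm_sub_le (x + s • (‖v‖⁻¹ • v)) x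
  have h2 : (ψ (x + s • (‖v‖⁻¹ • v)) - ψ x) / s ≤ L := by
    rw [div_le_iff₀ hs0]
    refine (le_abs_self _).trans (h1.trans ?_)
    rw [add_sub_cancel_left, norm_smul, he, Real.norm_eq_abs, abs_of_pos hs0, mul_one]
  have h3 : inner ℝ v (‖v‖⁻¹ • v) = ‖v‖ := by
    rw [inner_smul_right, real_inner_self_eq_norm_sq]
    field_simp
  rw [h3] at hs
  linarith

end Subgradient

/-! ### The hinge function -/

lemma hinge_sub_le_abs (a b : ℝ) : hinge a - hinge b ≤ |a - b| := by
  unfold hinge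
  rcases le_total 0 a with ha | ha <;> rcases le_total 0 b with hb | hb <;>
    simp only [max_eq_left, max_eq_right, ha, hb] <;>
    linarith [le_abs_self (a - b), abs_nonneg (a - b)]

lemma hinge_convex (a b s : ℝ) (h0 : 0 ≤ s) (h1 : s ≤ 1) :
    hinge (a + s * (b - a)) ≤ hinge a + s * (hinge b - hinge a) := by
  have ha : a ≤ hinge a := le_max_right _ _
  have hb : b ≤ hinge b := le_max_right _ _
  have ha0 : 0 ≤ hinge a := le_max_left _ _
  have hb0 : 0 ≤ hinge b := le_max_left _ _
  have h2 := mul_le_mul_of_nonneg_left ha (sub_nonneg.mpr h1)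
  have h3 := mul_le_mul_of_nonneg_left hb h0
  have h4 := mul_nonneg (sub_nonneg.mpr h1) ha0
  have h5 := mul_nonneg h0 hb0
  exact max_le (by linarith) (by linarith)

/-- The hinge function being convex, its Fréchet subgradients are global ones. -/
lemma IsSubgrad.hinge_le {u g : ℝ} (h : IsSubgrad hinge u g) (y : ℝ) :
    hinge u + g * (y - u) ≤ hinge y := by
  refine le_of_forall_pos_le_add fun c hc => ?_
  have hc' : 0 < c / (|y - u| + 1) := by positivity
  have ht : Filter.Tendsto (fun s : ℝ => u + s * (y - u)) (nhdsWithin 0 (Set.Ioi 0))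
      (nhds u) := by
    have : Continuous (fun s : ℝ => u + s * (y - u)) := by fun_prop
    simpa using (this.tendsto 0).mono_left nhdsWithin_le_nhds
  have h1 : ∀ᶠ s : ℝ in nhdsWithin 0 (Set.Ioi 0), s ≤ 1 :=
    nhdsWithin_le_nhds (Iic_mem_nhds one_pos)
  obtain ⟨s, ⟨hs, hs1⟩, hs0⟩ :=
    (((ht.eventually (h _ hc')).and h1).and self_mem_nhdsWithin).exists
  have hs0 : 0 < s := hs0
  have h2 := hinge_convex u y s hs0.le hs1
  simp only [add_sub_cancel_left, Real.norm_eq_abs, abs_mul, abs_of_pos hs0, RCLike.inner_apply,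
    conj_trivial] at hs
  have h3 : c / (|y - u| + 1) * (s * |y - u|) ≤ s * c := by
    have : c / (|y - u| + 1) * |y - u| ≤ c := by
      rw [div_mul_eq_mul_div, div_le_iff₀ (by positivity)]
      nlinarith [abs_nonneg (y - u)]
    nlinarith
  have h4 : s * (hinge u + g * (y - u)) ≤ s * (hinge y + c) := by nlinarith
  exact le_of_mul_le_mul_left h4 hs0

lemma IsSubgrad.hinge_nonneg {u g : ℝ} (h : IsSubgrad hinge u g) : 0 ≤ g := by
  have h1 := h.hinge_le (u - 1)
  have h2 : hinge (u - 1) ≤ hinge u := max_le_max le_rfl (by linarith)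
  linarith

lemma IsSubgrad.hinge_le_one {u g : ℝ} (h : IsSubgrad hinge u g) : g ≤ 1 := by
  have h1 := h.hinge_le (u + 1)
  have h2 := hinge_sub_le_abs (u + 1) u
  simp at h2
  linarith

lemma monotone_of_isSubgrad_hinge {g : ℝ → ℝ} (h : ∀ z, IsSubgrad hinge z (g z)) :
    Monotone g := by
  intro a b hab
  rcases hab.eq_or_lt with rfl | hab
  · rfl
  have h1 := (h a).hinge_le b
  have h2 := (h b).hinge_le a
  have h3 : (b - a) * g a ≤ (b - a) * g b := by linarith
  exact le_of_mul_le_mul_left h3 (by linarith)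

/-- Linearizing the hinge function at an estimate `u` of `b` costs twice the estimation error. -/
lemma IsSubgrad.mul_sub_le {u g : ℝ} (h : IsSubgrad hinge u g) (a b : ℝ) :
    g * (a - b) ≤ hinge a - hinge b + 2 * |u - b| := by
  have h1 := h.hinge_le a
  have h2 := hinge_sub_le_abs b u
  rw [abs_sub_comm] at h2
  have h3 : g * (u - b) ≤ |u - b| := by
    refine (le_abs_self _).trans ?_
    rw [abs_mul, abs_of_nonneg h.hinge_nonneg]
    exact mul_le_of_le_one_left (abs_nonneg _) h.hinge_le_one
  linarith

/-- The subdifferential of the hinge function is nonempty at every point. -/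
lemma exists_hinge_slope (u : ℝ) :
    ∃ g : ℝ, 0 ≤ g ∧ g ≤ 1 ∧ ∀ y, hinge u + g * (y - u) ≤ hinge y := by
  rcases le_total u 0 with hu | hu
  · refine ⟨0, le_rfl, zero_le_one, fun y => ?_⟩
    rw [hinge, max_eq_left hu, zero_mul, add_zero]
    exact le_max_left 0 y
  · refine ⟨1, zero_le_one, le_rfl, fun y => ?_⟩
    rw [hinge, max_eq_right hu]
    have : y ≤ hinge y := le_max_right _ _
    linarith

/-! ### Moreau envelopes of weakly convex functions -/

section Moreau

variable {V : Type*} [NormedAddCommGroup V]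

/-- `q` minimizes the function `ψ + ρ ‖· - x‖²`, that is, `q` is a proximal point of `x`
for the step size `1 / (2ρ)`. -/
def IsProx (ρ : ℝ) (ψ : V → ℝ) (x q : V) : Prop :=
  ∀ y, ψ q + ρ * ‖q - x‖ ^ 2 ≤ ψ y + ρ * ‖y - x‖ ^ 2

lemma exists_isProx [ProperSpace V] {ρ : ℝ} (hρ : 0 < ρ) {ψ : V → ℝ} {L : ℝ≥0}
    (hL : LipschitzWith L ψ) (x : V) : ∃ q, IsProx ρ ψ x q := by
  have hc : Continuous fun y => ψ y + ρ * ‖y - x‖ ^ 2 := by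
    have := hL.continuous
    fun_prop
  refine hc.exists_forall_le' x ?_
  have : (Metric.closedBall x (L / ρ))ᶜ ∈ Filter.cocompact V :=
    (isCompact_closedBall x (L / ρ)).compl_mem_cocompact
  filter_upwards [this] with y hy
  rw [Set.mem_compl_iff, Metric.mem_closedBall, not_le, dist_eq_norm, div_lt_iff₀ hρ] at hy
  have h1 := (le_abs_self _).trans (hL.norm_sub_le x y)
  rw [norm_sub_rev] at h1
  simp only [sub_self, norm_zero]
  nlinarith [norm_nonneg (y - x)]

lemma IsProx.moreauEnv_eq {ρ : ℝ} {ψ : V → ℝ} {x q : V} (hq : IsProx ρ ψ x q) :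
    moreauEnv (1 / (2 * ρ)) ψ x = ψ q + ρ * ‖q - x‖ ^ 2 := by
  have e : 1 / (2 * (1 / (2 * ρ))) = ρ := by
    rcases eq_or_ne ρ 0 with rfl | h
    · simp
    · field_simp
  unfold moreauEnv
  rw [e]
  have hb : BddBelow (Set.range fun y => ψ y + ρ * ‖y - x‖ ^ 2) :=
    ⟨ψ q + ρ * ‖q - x‖ ^ 2, by rintro _ ⟨y, rfl⟩; exact hq y⟩
  exact le_antisymm (ciInf_le hb q) (le_ciInf hq)

lemma IsProx.moreauEnv_le {ρ : ℝ} {ψ : V → ℝ} {x q : V} (hq : IsProx ρ ψ x q) (y : V) :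
    moreauEnv (1 / (2 * ρ)) ψ x ≤ ψ y + ρ * ‖y - x‖ ^ 2 :=
  hq.moreauEnv_eq.trans_le (hq y)

lemma IsProx.mul_norm_sub_le {ρ : ℝ} (hρ : 0 < ρ) {ψ : V → ℝ} {L : ℝ≥0}
    (hL : LipschitzWith L ψ) {x q : V} (hq : IsProx ρ ψ x q) : ρ * ‖q - x‖ ≤ L := by
  have h1 := hq x
  have h2 := (le_abs_self _).trans (hL.norm_sub_le x q)
  rw [norm_sub_rev] at h2
  simp only [sub_self, norm_zero] at h1
  by_contra! hlt
  have h3 : 0 < ‖q - x‖ := by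
    by_contra! h0
    have : ‖q - x‖ = 0 := le_antisymm h0 (norm_nonneg _)
    rw [this] at hlt
    have := L.2
    rw [mul_zero] at hlt
    exact absurd hlt (not_lt.mpr this)
  nlinarith

variable [InnerProductSpace ℝ V]

/-- `ψ` lies above a concave paraboloid of curvature `ρ` touching its graph at any given point.
For real-valued functions this is weak convexity together with the existence of subgradients. -/
def QuadSupported (ρ : ℝ) (ψ : V → ℝ) : Prop :=
  ∀ x, ∃ v : V, ∀ y, ψ x + inner ℝ v (y - x) - ρ / 2 * ‖y - x‖ ^ 2 ≤ ψ y

lemma QuadSupported.midpoint_le {ρ : ℝ} {ψ : V → ℝ} (h : QuadSupported ρ ψ) (a b : V) :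
    ψ ((1 / 2 : ℝ) • (a + b)) ≤ (ψ a + ψ b) / 2 + ρ / 8 * ‖a - b‖ ^ 2 := by
  obtain ⟨v, hv⟩ := h ((1 / 2 : ℝ) • (a + b))
  have ha := hv a
  have hb := hv b
  have e1 : a - (1 / 2 : ℝ) • (a + b) = (1 / 2 : ℝ) • (a - b) := by module
  have e2 : b - (1 / 2 : ℝ) • (a + b) = (-1 / 2 : ℝ) • (a - b) := by module
  have n1 : ‖(1 / 2 : ℝ)‖ = 1 / 2 := by norm_num
  have n2 : ‖(-1 / 2 : ℝ)‖ = 1 / 2 := by norm_num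
  rw [e1, norm_smul, inner_smul_right, mul_pow, n1] at ha
  rw [e2, norm_smul, inner_smul_right, mul_pow, n2] at hb
  linarith

/-- The function minimized by a proximal point is strongly convex; the midpoint version of strong
convexity is enough for quadratic growth. -/
lemma IsProx.quadratic_growth {ρ : ℝ} {ψ : V → ℝ} (h : QuadSupported ρ ψ) {x q : V}
    (hq : IsProx ρ ψ x q) (y : V) :
    ψ q + ρ * ‖q - x‖ ^ 2 + ρ / 4 * ‖y - q‖ ^ 2 ≤ ψ y + ρ * ‖y - x‖ ^ 2 := by
  have h1 := h.midpoint_le q y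
  have h2 := hq ((1 / 2 : ℝ) • (q + y))
  have e1 : (1 / 2 : ℝ) • (q + y) - x = (1 / 2 : ℝ) • ((q - x) + (y - x)) := by module
  have e2 : q - y = (q - x) - (y - x) := by abel
  have e3 : y - q = (y - x) - (q - x) := by abel
  have n1 : ‖(1 / 2 : ℝ)‖ = 1 / 2 := by norm_num
  rw [e1, norm_smul, mul_pow, norm_add_sq_real, n1] at h2
  rw [e2, norm_sub_sq_real] at h1
  rw [e3, norm_sub_sq_real (y - x), real_inner_comm]
  linarith

lemma IsProx.norm_sub_le {ρ : ℝ} (hρ : 0 < ρ) {ψ : V → ℝ} (h : QuadSupported ρ ψ)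
    {x q y r : V} (hq : IsProx ρ ψ x q) (hr : IsProx ρ ψ y r) : ‖r - q‖ ≤ 4 * ‖y - x‖ := by
  have h1 := hq.quadratic_growth h r
  have h2 := hr.quadratic_growth h q
  have e1 : q - y = (q - x) - (y - x) := by abel
  have e2 : r - x = (r - q) + (q - x) := by abel
  have e3 : r - y = (r - q) + ((q - x) - (y - x)) := by abel
  rw [norm_sub_rev q r, e1, e3, norm_add_sq_real (r - q), inner_sub_right] at h2
  rw [e2, norm_add_sq_real] at h1
  have h3 : ρ / 2 * ‖r - q‖ ^ 2 ≤ 2 * ρ * inner ℝ (r - q) (y - x) := by linarith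
  have h4 := real_inner_le_norm (r - q) (y - x)
  have h5 : ρ * (‖r - q‖ ^ 2) ≤ ρ * (4 * (‖r - q‖ * ‖y - x‖)) := by nlinarith
  have h6 := le_of_mul_le_mul_left h5 hρ
  by_contra! hlt
  have h7 : 0 < ‖r - q‖ := lt_of_le_of_lt (by positivity) hlt
  nlinarith

/-- The gradient of the Moreau envelope at `x` is `2ρ (x - q)` for the proximal point `q`. Inserting
`q` into the infimum at `y` bounds the envelope above; exchanging the roles of `x` and `y` bounds it
below, and the two bounds agree to first order because proximal points depend on their base point in
a Lipschitz way. -/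
lemma IsProx.hasGradientAt [CompleteSpace V] {ρ : ℝ} (hρ : 0 < ρ) {ψ : V → ℝ}
    (h : QuadSupported ρ ψ) (hex : ∀ y, ∃ r, IsProx ρ ψ y r) {x q : V} (hq : IsProx ρ ψ x q) :
    HasGradientAt (moreauEnv (1 / (2 * ρ)) ψ) ((2 * ρ) • (x - q)) x := by
  rw [hasGradientAt_iff_isLittleO]
  refine Asymptotics.IsBigO.trans_isLittleO (g := fun y => ‖y - x‖ ^ 2) ?_ ?_
  · refine Asymptotics.IsBigO.of_bound (9 * ρ) (Filter.Eventually.of_forall fun y => ?_)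
    obtain ⟨r, hr⟩ := hex y
    have h1 := hr.moreauEnv_le q
    have h2 := hq.moreauEnv_le r
    have e1 : q - y = (q - x) - (y - x) := by abel
    have e2 : r - x = (r - y) + (y - x) := by abel
    have e3 : x - q = -(q - x) := by abel
    have e4 : r - y = (r - q) + ((q - x) - (y - x)) := by abel
    have h3 := hq.moreauEnv_eq
    have h4 := hr.moreauEnv_eq
    rw [e1, norm_sub_sq_real] at h1
    have e5 : inner ℝ (r - y) (y - x)
        = inner ℝ (r - q) (y - x) + (inner ℝ (q - x) (y - x) - ‖y - x‖ ^ 2) := by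
      rw [e4, inner_add_left, inner_sub_left (q - x), real_inner_self_eq_norm_sq]
    rw [e2, norm_add_sq_real, e5] at h2
    have h5 := abs_le.mp ((abs_real_inner_le_norm (r - q) (y - x)).trans
      (mul_le_mul_of_nonneg_right (hq.norm_sub_le hρ h hr) (norm_nonneg (y - x))))
    rw [e3, inner_smul_left, inner_neg_left]
    simp only [conj_trivial, Real.norm_eq_abs, abs_pow, abs_norm]
    have h6 := mul_le_mul_of_nonneg_left h5.1 hρ.le
    have h7 := mul_le_mul_of_nonneg_left h5.2 hρ.le
    have h8 : 0 ≤ ρ * ‖y - x‖ ^ 2 := by positivity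
    rw [abs_le]
    constructor <;> linarith
  · have hz : Filter.Tendsto (fun y => ‖y - x‖) (nhds x) (nhds 0) := by
      have : Continuous fun y => ‖y - x‖ := by fun_prop
      simpa using this.tendsto x
    have h1 : (fun y => ‖y - x‖) =o[nhds x] fun _ => (1 : ℝ) :=
      (Asymptotics.isLittleO_one_iff ℝ).mpr hz
    have h2 := h1.mul_isBigO (Asymptotics.isBigO_refl (fun y => ‖y - x‖) (nhds x))
    refine (h2.congr_left fun y => (sq _).symm).trans_isBigO ?_
    simpa using Asymptotics.isBigO_norm_left.mpr (Asymptotics.isBigO_refl _ _)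

lemma IsProx.norm_gradient [CompleteSpace V] {ρ : ℝ} (hρ : 0 < ρ) {ψ : V → ℝ}
    (h : QuadSupported ρ ψ) (hex : ∀ y, ∃ r, IsProx ρ ψ y r) {x q : V} (hq : IsProx ρ ψ x q) :
    ‖∇ (moreauEnv (1 / (2 * ρ)) ψ) x‖ = 2 * ρ * ‖q - x‖ := by
  rw [(hq.hasGradientAt hρ h hex).gradient, norm_smul, Real.norm_eq_abs,
    abs_of_pos (by positivity), norm_sub_rev]

end Moreau

/-! ### The penalty function -/

section Penalty

variable {d m : ℕ} {Z Ξ : Type*} [MeasurableSpace Z] [MeasurableSpace Ξ] {p : Problem d m Z Ξ}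
  {ρ₀ ρ₁ : ℝ} {L_F L_h : ℝ≥0} {σ_f σ_h : ℝ}

lemma Problem.Assumptions.F_ge (A : p.Assumptions ρ₀ ρ₁ L_F L_h σ_f σ_h) (x y : E d) :
    p.F x + inner ℝ (∫ ζ, p.df x ζ ∂p.lawZ) (y - x) - ρ₀ / 2 * ‖y - x‖ ^ 2 ≤ p.F y :=
  A.weaklyConvex_F y x _ (A.mean_df x)

lemma Problem.Assumptions.H_ge (A : p.Assumptions ρ₀ ρ₁ L_F L_h σ_f σ_h) (k : Fin m)
    (x y : E d) :
    p.H k x + inner ℝ (∫ ξ, p.dh k x ξ ∂p.lawΞ k) (y - x) - ρ₁ / 2 * ‖y - x‖ ^ 2 ≤ p.H k y :=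
  A.weaklyConvex_H k y x _ (A.mean_dh k x)

lemma div_mul_sum_const_le {β c : ℝ} (hβ : 0 ≤ β) (hc : 0 ≤ c) :
    β / m * ∑ _k : Fin m, c ≤ β * c := by
  rcases Nat.eq_zero_or_pos m with rfl | hm
  · simpa using mul_nonneg hβ hc
  · have : (0 : ℝ) < m := by exact_mod_cast hm
    rw [Finset.sum_const, Finset.card_univ, Fintype.card_fin, nsmul_eq_mul]
    apply le_of_eq
    field_simp

lemma Problem.Assumptions.quadSupported_Phi (A : p.Assumptions ρ₀ ρ₁ L_F L_h σ_f σ_h)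
    (hρ₁ : 0 ≤ ρ₁) {β : ℝ} (hβ : 0 ≤ β) : QuadSupported (ρ₀ + ρ₁ * β) (p.Phi β) := by
  intro x
  choose s hs0 hs1 hs using fun k => exists_hinge_slope (p.H k x)
  refine ⟨(∫ ζ, p.df x ζ ∂p.lawZ) + (β / m) • ∑ k, s k • ∫ ξ, p.dh k x ξ ∂p.lawΞ k, fun y => ?_⟩
  have hk : ∀ k, hinge (p.H k x) + s k * inner ℝ (∫ ξ, p.dh k x ξ ∂p.lawΞ k) (y - x)
      - ρ₁ / 2 * ‖y - x‖ ^ 2 ≤ hinge (p.H k y) := fun k => by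
    have h1 := hs k (p.H k y)
    have h2 := mul_le_mul_of_nonneg_left (A.H_ge k x y) (hs0 k)
    have h3 : s k * (ρ₁ / 2 * ‖y - x‖ ^ 2) ≤ ρ₁ / 2 * ‖y - x‖ ^ 2 :=
      mul_le_of_le_one_left (by positivity) (hs1 k)
    linarith
  have hsum := Finset.sum_le_sum fun k (_ : k ∈ Finset.univ) => hk k
  rw [Finset.sum_sub_distrib, Finset.sum_add_distrib] at hsum
  have h4 := mul_le_mul_of_nonneg_left hsum (show 0 ≤ β / m by positivity)
  have h5 := div_mul_sum_const_le (m := m) hβ (show 0 ≤ ρ₁ / 2 * ‖y - x‖ ^ 2 by positivity)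
  have h6 := A.F_ge x y
  rw [inner_add_left, inner_smul_left, sum_inner]
  simp only [inner_smul_left, conj_trivial, Problem.Phi]
  linarith

lemma Problem.Assumptions.lipschitz_Phi (A : p.Assumptions ρ₀ ρ₁ L_F L_h σ_f σ_h)
    {β : ℝ} (hβ : 0 ≤ β) : LipschitzWith (L_F + β.toNNReal * L_h) (p.Phi β) := by
  refine LipschitzWith.of_le_add_mul _ fun x y => ?_
  have h1 := (le_abs_self _).trans (A.lipschitz_F.norm_sub_le x y)
  have hk : ∀ k, hinge (p.H k x) - hinge (p.H k y) ≤ L_h * ‖x - y‖ := fun k =>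
    (hinge_sub_le_abs _ _).trans ((A.lipschitz_H k).norm_sub_le x y)
  have hsum := Finset.sum_le_sum fun k (_ : k ∈ Finset.univ) => hk k
  rw [Finset.sum_sub_distrib] at hsum
  have h4 := mul_le_mul_of_nonneg_left hsum (show 0 ≤ β / m by positivity)
  have h5 := div_mul_sum_const_le (m := m) hβ (show 0 ≤ L_h * ‖x - y‖ by positivity)
  rw [dist_eq_norm]
  push_cast
  rw [Real.coe_toNNReal _ hβ]
  simp only [Problem.Phi]
  linarith

/-- To first order, a step against the expected update direction decreases the distance to the
proximal point `q`, up to the error of the estimators `u` of the constraint values. -/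
lemma Problem.Assumptions.inner_direction_le (A : p.Assumptions ρ₀ ρ₁ L_F L_h σ_f σ_h)
    (hρ₁ : 0 ≤ ρ₁) {β : ℝ} (hβ : 0 ≤ β) {hinge' : ℝ → ℝ}
    (hh : ∀ z, IsSubgrad hinge z (hinge' z)) {x q : E d}
    (hq : IsProx (ρ₀ + ρ₁ * β) (p.Phi β) x q) (u : Fin m → ℝ) :
    inner ℝ (q - x) ((∫ ζ, p.df x ζ ∂p.lawZ)
        + (β / m) • ∑ k, hinge' (u k) • ∫ ξ, p.dh k x ξ ∂p.lawΞ k)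
      ≤ -((ρ₀ + ρ₁ * β) / 2) * ‖q - x‖ ^ 2 + 2 * β / m * ∑ k, |u k - p.H k x| := by
  have hk : ∀ k, hinge' (u k) * inner ℝ (∫ ξ, p.dh k x ξ ∂p.lawΞ k) (q - x)
      ≤ hinge (p.H k q) - hinge (p.H k x) + 2 * |u k - p.H k x|
        + ρ₁ / 2 * ‖q - x‖ ^ 2 := fun k => by
    have h1 := (hh (u k)).mul_sub_le (p.H k q) (p.H k x)
    have h2 := mul_le_mul_of_nonneg_left (A.H_ge k x q) (hh (u k)).hinge_nonneg
    have h3 : hinge' (u k) * (ρ₁ / 2 * ‖q - x‖ ^ 2) ≤ ρ₁ / 2 * ‖q - x‖ ^ 2 :=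
      mul_le_of_le_one_left (by positivity) (hh (u k)).hinge_le_one
    linarith
  have hsum := Finset.sum_le_sum fun k (_ : k ∈ Finset.univ) => hk k
  rw [Finset.sum_add_distrib, Finset.sum_add_distrib, Finset.sum_sub_distrib,
    ← Finset.mul_sum] at hsum
  have h4 := mul_le_mul_of_nonneg_left hsum (show 0 ≤ β / m by positivity)
  have h5 := div_mul_sum_const_le (m := m) hβ (show 0 ≤ ρ₁ / 2 * ‖q - x‖ ^ 2 by positivity)
  have h6 := A.F_ge x q
  have h7 := hq x
  rw [real_inner_comm, inner_add_left, inner_smul_left, sum_inner]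
  simp only [inner_smul_left, conj_trivial]
  simp only [Problem.Phi, sub_self, norm_zero] at h7
  have e : 2 * β / m * ∑ k, |u k - p.H k x| = β / m * (2 * ∑ k, |u k - p.H k x|) := by ring
  rw [e]
  linarith

/-! ### Second moments of the stochastic subgradients -/

/-- Fatou's lemma turns the mean square Lipschitz condition into a bound on the positive part of
the component of `∂h_k(x, ξ)` in a given direction. -/
lemma Problem.Assumptions.lintegral_inner_dh_le (A : p.Assumptions ρ₀ ρ₁ L_F L_h σ_f σ_h)
    (k : Fin m) (x : E d) {e : E d} (he : ‖e‖ = 1) :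
    ∫⁻ ξ, ENNReal.ofReal (max (inner ℝ (p.dh k x ξ) e) 0 ^ 2) ∂p.lawΞ k
      ≤ ENNReal.ofReal (L_h ^ 2) := by
  set s : ℕ → ℝ := fun n => 1 / ((n : ℝ) + 1) with hs
  have hspos : ∀ n, 0 < s n := fun n => by simp only [hs]; positivity
  have hs0 : Filter.Tendsto s Filter.atTop (nhdsWithin 0 (Set.Ioi 0)) :=
    tendsto_nhdsWithin_iff.mpr ⟨tendsto_one_div_add_atTop_nhds_zero_nat,
      Filter.Eventually.of_forall hspos⟩
  set D : ℕ → Ξ → ENNReal := fun n ξ =>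
    ENNReal.ofReal (((p.h k (x + s n • e) ξ - p.h k x ξ) / s n) ^ 2) with hD
  have hmeas : ∀ y, Measurable (p.h k y) := fun y => (A.measurable_h k).of_uncurry_left
  have hDm : ∀ n, Measurable (D n) := fun n =>
    ((((hmeas _).sub (hmeas _)).div_const _).pow_const 2).ennreal_ofReal
  have hDi : ∀ n, ∫⁻ ξ, D n ξ ∂p.lawΞ k ≤ ENNReal.ofReal (L_h ^ 2) := fun n => by
    obtain ⟨hi, hle⟩ := A.meanSquareLipschitz_h k (x + s n • e) x
    simp only [Real.norm_eq_abs, sq_abs] at hi hle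
    rw [add_sub_cancel_left, norm_smul, he, mul_one, Real.norm_eq_abs, sq_abs] at hle
    simp only [hD, div_pow]
    rw [← ofReal_integral_eq_lintegral_ofReal (hi.div_const _)
      (Filter.Eventually.of_forall fun ξ => by positivity)]
    refine ENNReal.ofReal_le_ofReal ?_
    rw [integral_div, div_le_iff₀ (by have := hspos n; positivity)]
    exact hle
  calc ∫⁻ ξ, ENNReal.ofReal (max (inner ℝ (p.dh k x ξ) e) 0 ^ 2) ∂p.lawΞ k
      ≤ ∫⁻ ξ, Filter.liminf (fun n => D n ξ) Filter.atTop ∂p.lawΞ k := by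
        refine lintegral_mono_ae ?_
        filter_upwards [A.subgrad_h k x] with ξ hξ
        have ht : Filter.Tendsto
            (fun c : ℝ => ENNReal.ofReal (max (inner ℝ (p.dh k x ξ) e - c) 0 ^ 2))
            (nhdsWithin 0 (Set.Ioi 0))
            (nhds (ENNReal.ofReal (max (inner ℝ (p.dh k x ξ) e) 0 ^ 2))) := by
          have : Continuous
              (fun c : ℝ => ENNReal.ofReal (max (inner ℝ (p.dh k x ξ) e - c) 0 ^ 2)) :=
            ENNReal.continuous_ofReal.comp (by fun_prop)
          simpa using (this.tendsto 0).mono_left nhdsWithin_le_nhds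
        refine le_of_tendsto ht ?_
        filter_upwards [self_mem_nhdsWithin] with c hc
        refine Filter.le_liminf_of_le (by isBoundedDefault) ?_
        filter_upwards [hs0.eventually (hξ.eventually_sub_le_slope he hc)] with n hn
        refine ENNReal.ofReal_le_ofReal ?_
        rcases le_total (inner ℝ (p.dh k x ξ) e - c) 0 with h | h
        · rw [max_eq_right h, zero_pow two_ne_zero]; positivity
        · rw [max_eq_left h]; exact pow_le_pow_left₀ h hn 2
    _ ≤ Filter.liminf (fun n => ∫⁻ ξ, D n ξ ∂p.lawΞ k) Filter.atTop := lintegral_liminf_le hDm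
    _ ≤ ENNReal.ofReal (L_h ^ 2) :=
        Filter.liminf_le_of_le (by isBoundedDefault) fun b hb => by
          obtain ⟨n, hn⟩ := hb.exists
          exact hn.trans (hDi n)

/-- The mean square Lipschitz condition bounds the second moment of the stochastic subgradients,
one coordinate direction at a time. -/
lemma Problem.Assumptions.secondMoment_dh (A : p.Assumptions ρ₀ ρ₁ L_F L_h σ_f σ_h)
    (k : Fin m) (x : E d) :
    SecondMomentLE (p.lawΞ k) (p.dh k x) (2 * d * L_h ^ 2) := by
  have hmeas : Measurable (p.dh k x) := (A.measurable_dh k).of_uncurry_left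
  have hm2 : Measurable fun ξ => ‖p.dh k x ξ‖ ^ 2 := hmeas.norm.pow_const 2
  have hpt : ∀ v : E d, ENNReal.ofReal (‖v‖ ^ 2) = ∑ i : Fin d,
      (ENNReal.ofReal (max (inner ℝ v (EuclideanSpace.single i (1 : ℝ))) 0 ^ 2)
        + ENNReal.ofReal (max (inner ℝ v (-EuclideanSpace.single i (1 : ℝ))) 0 ^ 2)) := fun v => by
    rw [EuclideanSpace.norm_sq_eq, ENNReal.ofReal_sum_of_nonneg fun i _ => by positivity]
    refine Finset.sum_congr rfl fun i _ => ?_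
    rw [← ENNReal.ofReal_add (by positivity) (by positivity)]
    have : inner ℝ v (EuclideanSpace.single i (1 : ℝ)) = v i := by
      simp [EuclideanSpace.inner_single_right]
    rw [inner_neg_right, this, Real.norm_eq_abs, sq_abs]
    congr 1
    rcases le_total (v i) 0 with h | h
    · rw [max_eq_right h, max_eq_left (by linarith)]; ring
    · rw [max_eq_left h, max_eq_right (by linarith)]; ring
  have hle : ∫⁻ ξ, ENNReal.ofReal (‖p.dh k x ξ‖ ^ 2) ∂p.lawΞ k
      ≤ ENNReal.ofReal (2 * d * L_h ^ 2) := by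
    simp_rw [hpt]
    have hmi : ∀ e : E d, Measurable fun ξ =>
        ENNReal.ofReal (max (inner ℝ (p.dh k x ξ) e) 0 ^ 2) := fun e =>
      (((hmeas.inner_const).max measurable_const).pow_const 2).ennreal_ofReal
    rw [lintegral_finsetSum _ fun i _ => by exact (hmi _).add (hmi _)]
    calc _ ≤ ∑ _i : Fin d, ENNReal.ofReal (2 * L_h ^ 2) := by
          refine Finset.sum_le_sum fun i _ => ?_
          rw [lintegral_add_left (hmi _), two_mul, ENNReal.ofReal_add (by positivity)
            (by positivity)]
          exact add_le_add (A.lintegral_inner_dh_le k x (by simp))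
            (A.lintegral_inner_dh_le k x (by simp))
      _ = ENNReal.ofReal (2 * d * L_h ^ 2) := by
          rw [← ENNReal.ofReal_sum_of_nonneg fun i _ => by positivity]
          congr 1
          simp
          ring
  have hint : Integrable (fun ξ => ‖p.dh k x ξ‖ ^ 2) (p.lawΞ k) := by
    refine ⟨hm2.aestronglyMeasurable, ?_⟩
    rw [hasFiniteIntegral_iff_ofReal (Filter.Eventually.of_forall fun ξ => by positivity)]
    exact hle.trans_lt ENNReal.ofReal_lt_top
  refine ⟨hint, ?_⟩
  rw [← ofReal_integral_eq_lintegral_ofReal hint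
    (Filter.Eventually.of_forall fun ξ => by positivity)] at hle
  exact (ENNReal.ofReal_le_ofReal_iff (by positivity)).mp hle

lemma norm_add_sq_le_two {V : Type*} [SeminormedAddCommGroup V] (a b : V) :
    ‖a + b‖ ^ 2 ≤ 2 * ‖a‖ ^ 2 + 2 * ‖b‖ ^ 2 := by
  have h := norm_add_le a b
  nlinarith [norm_nonneg (a + b), sq_nonneg (‖a‖ - ‖b‖)]

lemma Problem.Assumptions.secondMoment_df (A : p.Assumptions ρ₀ ρ₁ L_F L_h σ_f σ_h) (x : E d) :
    SecondMomentLE p.lawZ (p.df x) (2 * (σ_f ^ 2 + L_F ^ 2)) := by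
  have := A.probZ
  obtain ⟨hi, hle⟩ := A.variance_df x
  set g := ∫ ζ, p.df x ζ ∂p.lawZ with hg
  have hgn : ‖g‖ ≤ L_F := (A.mean_df x).norm_le A.lipschitz_F
  have hb : ∀ ζ, ‖p.df x ζ‖ ^ 2 ≤ 2 * ‖p.df x ζ - g‖ ^ 2 + 2 * ‖g‖ ^ 2 := fun ζ => by
    simpa using norm_add_sq_le_two (p.df x ζ - g) g
  have hib : Integrable (fun ζ => 2 * ‖p.df x ζ - g‖ ^ 2 + 2 * ‖g‖ ^ 2) p.lawZ :=
    (hi.const_mul 2).add (integrable_const _)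
  have hmeas : Measurable (p.df x) := A.measurable_df.of_uncurry_left
  have hint : Integrable (fun ζ => ‖p.df x ζ‖ ^ 2) p.lawZ :=
    hib.mono' (hmeas.norm.pow_const 2).aestronglyMeasurable
      (Filter.Eventually.of_forall fun ζ => by
        rw [Real.norm_of_nonneg (by positivity)]; exact hb ζ)
  refine ⟨hint, (integral_mono hint hib hb).trans ?_⟩
  rw [integral_add (hi.const_mul 2) (integrable_const _), integral_const_mul]
  simp only [integral_const, probReal_univ, smul_eq_mul, one_mul]
  have := pow_le_pow_left₀ (norm_nonneg g) hgn 2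
  linarith

end Penalty

/-! ### Mini-batch averages -/

lemma norm_sum_sq_le {ι V : Type*} [SeminormedAddCommGroup V] (s : Finset ι) (v : ι → V) :
    ‖∑ i ∈ s, v i‖ ^ 2 ≤ s.card * ∑ i ∈ s, ‖v i‖ ^ 2 :=
  (pow_le_pow_left₀ (norm_nonneg _) (norm_sum_le s v) 2).trans sq_sum_le_card_mul_sum_sq

section Batch

variable {α : Type*} [MeasurableSpace α] {ν : Measure α} [IsProbabilityMeasure ν] {b : ℕ}
  {V : Type*} [NormedAddCommGroup V] [NormedSpace ℝ V]

lemma integrable_batchMean {g : α → V} (hg : Integrable g ν) :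
    Integrable (fun B : Fin b → α => batchMean g B) (Measure.pi fun _ => ν) :=
  (integrable_finsetSum _ fun j _ => integrable_comp_eval (i := j) hg).smul _

lemma integral_batchMean (hb : 1 ≤ b) {g : α → V} (hg : Integrable g ν) :
    ∫ B : Fin b → α, batchMean g B ∂(Measure.pi fun _ => ν) = ∫ a, g a ∂ν := by
  have hb' : (b : ℝ) ≠ 0 := by positivity
  unfold batchMean
  rw [integral_smul, integral_finsetSum _ fun j _ => integrable_comp_eval (i := j) hg]
  have : ∀ j : Fin b, ∫ B : Fin b → α, g (B j) ∂(Measure.pi fun _ => ν) = ∫ a, g a ∂ν :=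
    fun j => integral_comp_eval (μ := fun _ : Fin b => ν) hg.aestronglyMeasurable
  simp_rw [this]
  rw [Finset.sum_const, Finset.card_univ, Fintype.card_fin, ← Nat.cast_smul_eq_nsmul ℝ, smul_smul,
    inv_mul_cancel₀ hb', one_smul]

/-- Averaging does not increase second moments. -/
lemma SecondMomentLE.batchMean [MeasurableSpace V] [OpensMeasurableSpace V] (hb : 1 ≤ b)
    {g : α → V} (hgm : AEStronglyMeasurable g ν) {c : ℝ} (hg : SecondMomentLE ν g c) :
    SecondMomentLE (Measure.pi fun _ : Fin b => ν) (fun B => batchMean g B) c := by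
  have hb' : (0 : ℝ) < b := by positivity
  have hpt : ∀ B : Fin b → α,
      ‖HingePenalty.batchMean g B‖ ^ 2 ≤ (b : ℝ)⁻¹ * ∑ j, ‖g (B j)‖ ^ 2 := fun B => by
    have h := norm_sum_sq_le Finset.univ fun j => g (B j)
    rw [Finset.card_univ, Fintype.card_fin] at h
    unfold HingePenalty.batchMean
    rw [norm_smul, norm_inv, Real.norm_natCast, mul_pow]
    calc _ ≤ ((b : ℝ)⁻¹) ^ 2 * (b * ∑ j, ‖g (B j)‖ ^ 2) := by gcongr
      _ = _ := by field_simp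
  have hi : ∀ j : Fin b, Integrable (fun B : Fin b → α => ‖g (B j)‖ ^ 2)
      (Measure.pi fun _ => ν) := fun j =>
    integrable_comp_eval (μ := fun _ : Fin b => ν) (i := j) (f := fun a => ‖g a‖ ^ 2) hg.1
  have hsum : Integrable (fun B : Fin b → α => (b : ℝ)⁻¹ * ∑ j, ‖g (B j)‖ ^ 2)
      (Measure.pi fun _ => ν) := (integrable_finsetSum _ fun j _ => hi j).const_mul _
  have hgj : ∀ j : Fin b, AEStronglyMeasurable (fun B : Fin b → α => g (B j))
      (Measure.pi fun _ => ν) := fun j =>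
    hgm.comp_measurePreserving (measurePreserving_eval (fun _ : Fin b => ν) j)
  have hm : AEStronglyMeasurable (fun B : Fin b → α => HingePenalty.batchMean g B)
      (Measure.pi fun _ => ν) :=
    (Finset.aestronglyMeasurable_fun_sum Finset.univ fun j _ => hgj j).const_smul _
  have hint : Integrable (fun B : Fin b → α => ‖HingePenalty.batchMean g B‖ ^ 2)
      (Measure.pi fun _ => ν) := hsum.mono' (hm.norm.pow 2)
    (Filter.Eventually.of_forall fun B => by
      rw [Real.norm_of_nonneg (by positivity)]; exact hpt B)
  refine ⟨hint, (integral_mono hint hsum hpt).trans ?_⟩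
  rw [integral_const_mul, integral_finsetSum _ fun j _ => hi j]
  have : ∀ j : Fin b, ∫ B : Fin b → α, ‖g (B j)‖ ^ 2 ∂(Measure.pi fun _ => ν)
      = ∫ a, ‖g a‖ ^ 2 ∂ν := fun j =>
    integral_comp_eval (μ := fun _ : Fin b => ν) (f := fun a => ‖g a‖ ^ 2)
      hg.1.aestronglyMeasurable
  simp_rw [this]
  rw [Finset.sum_const, Finset.card_univ, Fintype.card_fin, nsmul_eq_mul,
    inv_mul_cancel_left₀ hb'.ne']
  exact hg.2

/-- The average of a mini-batch of centred real samples has a variance smaller by the factor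
`1 / b`; a deterministic shift `c` contributes `c ^ 2`. -/
lemma secondMoment_const_add_batchMean (hb : 1 ≤ b) {g : α → ℝ} (hgm : Measurable g) {s : ℝ}
    (hg : SecondMomentLE ν g s) (h0 : ∫ a, g a ∂ν = 0) (c : ℝ) :
    SecondMomentLE (Measure.pi fun _ : Fin b => ν) (fun B => c + batchMean g B)
      (c ^ 2 + s / b) := by
  have hb' : (0 : ℝ) < b := by positivity
  have hg2 : MemLp g 2 ν := by
    rw [memLp_two_iff_integrable_sq hgm.aestronglyMeasurable]
    simpa using hg.1
  have hgi : Integrable g ν := hg2.integrable one_le_two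
  set P : Measure (Fin b → α) := Measure.pi fun _ => ν with hP
  have hX : ∀ j : Fin b, MemLp (fun B : Fin b → α => g (B j)) 2 P := fun j =>
    hg2.comp_measurePreserving (measurePreserving_eval (fun _ : Fin b => ν) j)
  have hS : MemLp (fun B : Fin b → α => batchMean g B) 2 P :=
    (memLp_finsetSum Finset.univ fun j _ => hX j).const_smul ((b : ℝ)⁻¹)
  have hmean : ∫ B, batchMean g B ∂P = 0 := (integral_batchMean hb hgi).trans h0
  have hvar : Var[fun B => batchMean g B; P] ≤ s / b := by
    have h1 : (fun B : Fin b → α => batchMean g B)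
        = fun B => (b : ℝ)⁻¹ * (∑ j, fun B : Fin b → α => g (B j)) B := by
      ext B
      simp [batchMean]
    rw [h1, variance_const_mul, IndepFun.variance_sum fun j _ => hX j]
    · have h2 : ∀ j : Fin b, Var[fun B : Fin b → α => g (B j); P] ≤ s := fun j => by
        have h3 : ∫ B, g (B j) ∂P = 0 :=
          (integral_comp_eval (μ := fun _ : Fin b => ν) hgi.aestronglyMeasurable).trans h0
        rw [variance_of_integral_eq_zero (hX j).aemeasurable h3]
        have h4 : ∫ B, g (B j) ^ 2 ∂P = ∫ a, g a ^ 2 ∂ν :=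
          integral_comp_eval (μ := fun _ : Fin b => ν) (f := fun a => g a ^ 2)
            (hgm.pow_const 2).aestronglyMeasurable
        rw [h4]
        simpa using hg.2
      calc _ ≤ ((b : ℝ)⁻¹) ^ 2 * ∑ _j : Fin b, s := by gcongr with j; exact h2 j
        _ = s / b := by
          rw [Finset.sum_const, Finset.card_univ, Fintype.card_fin, nsmul_eq_mul]
          field_simp
    · intro i _ j _ hij
      exact (iIndepFun_pi (μ := fun _ : Fin b => ν) (X := fun _ => g)
        fun _ => hgm.aemeasurable).indepFun hij
  rw [variance_of_integral_eq_zero hS.aemeasurable hmean] at hvar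
  have hSi : Integrable (fun B => batchMean g B) P := hS.integrable one_le_two
  have hS2 : Integrable (fun B => batchMean g B ^ 2) P := hS.integrable_sq
  have hexp : ∀ B : Fin b → α, ‖c + batchMean g B‖ ^ 2 = c ^ 2 + 2 * c * batchMean g B
      + batchMean g B ^ 2 := fun B => by
    rw [Real.norm_eq_abs, sq_abs]; ring
  simp only [SecondMomentLE, hexp]
  have hi1 : Integrable (fun B => c ^ 2 + 2 * c * batchMean g B) P :=
    (integrable_const _).add (hSi.const_mul _)
  refine ⟨hi1.add hS2, ?_⟩
  rw [integral_add hi1 hS2, integral_add (integrable_const _) (hSi.const_mul _),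
    integral_const_mul, hmean]
  simp only [integral_const, probReal_univ, smul_eq_mul, one_mul, mul_zero, add_zero]
  linarith

end Batch

/-! ### The law of the samples of one iteration -/

section SampleLaw

lemma card_filter_mem_powersetCard {m : ℕ} (bc : ℕ) (hbc : 1 ≤ bc) (k : Fin m) :
    m * {B ∈ Finset.powersetCard bc (Finset.univ : Finset (Fin m)) | k ∈ B}.card
      = m.choose bc * bc := by
  obtain ⟨c, rfl⟩ : ∃ c, bc = c + 1 := ⟨bc - 1, by omega⟩
  obtain ⟨n, rfl⟩ : ∃ n, m = n + 1 := ⟨m - 1, by have := k.2; omega⟩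
  have h1 := Finset.card_filter_add_card_filter_not
    (s := Finset.powersetCard (c + 1) (Finset.univ : Finset (Fin (n + 1)))) (fun B => k ∈ B)
  have h2 : {B ∈ Finset.powersetCard (c + 1) (Finset.univ : Finset (Fin (n + 1))) | k ∉ B}
      = Finset.powersetCard (c + 1) (Finset.univ.erase k) := by
    ext B
    simp only [Finset.mem_filter, Finset.mem_powersetCard, Finset.subset_univ, true_and,
      Finset.subset_erase]
    tauto
  rw [h2, Finset.card_powersetCard, Finset.card_powersetCard, Finset.card_erase_of_mem
    (Finset.mem_univ _), Finset.card_univ, Fintype.card_fin, Nat.add_sub_cancel,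
    Nat.choose_succ_succ] at h1
  have h3 : {B ∈ Finset.powersetCard (c + 1) (Finset.univ : Finset (Fin (n + 1))) | k ∈ B}.card
      = n.choose c := by simpa using h1
  rw [h3, Nat.add_one_mul_choose_eq]

lemma setOf_card_eq_coe {m : ℕ} (bc : ℕ) :
    {B : Finset (Fin m) | B.card = bc}
      = ↑(Finset.powersetCard bc (Finset.univ : Finset (Fin m))) := by
  ext B
  simp

lemma isProbabilityMeasure_indexLaw {m bc : ℕ} (hbc : bc ≤ m) :
    IsProbabilityMeasure (uniformOn {B : Finset (Fin m) | B.card = bc}) := by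
  refine isProbabilityMeasure_uniformOn (Set.toFinite _) ?_
  obtain ⟨B, -, hB⟩ := Finset.exists_subset_card_eq
    (s := (Finset.univ : Finset (Fin m))) (n := bc) (by simpa using hbc)
  exact ⟨B, hB⟩

/-- Every index is sampled with probability `bc / m`. -/
lemma integral_mem_indexLaw {m bc : ℕ} (hbc : 1 ≤ bc) (hbm : bc ≤ m) (k : Fin m) :
    ∫ B : Finset (Fin m), (if k ∈ B then (1 : ℝ) else 0)
      ∂(uniformOn {B : Finset (Fin m) | B.card = bc}) = bc / m := by
  have e : (fun B : Finset (Fin m) => if k ∈ B then (1 : ℝ) else 0)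
      = Set.indicator {B | k ∈ B} 1 := by
    ext B
    simp [Set.indicator_apply]
  have hm : (0 : ℝ) < m := by exact_mod_cast (hbc.trans hbm)
  have hc : (0 : ℝ) < m.choose bc := by exact_mod_cast Nat.choose_pos hbm
  have h := card_filter_mem_powersetCard bc hbc k
  rw [e, integral_indicator_one (Set.toFinite _).measurableSet, setOf_card_eq_coe]
  have e2 : {B : Finset (Fin m) | k ∈ B} = ↑(Finset.univ.filter fun B : Finset (Fin m) => k ∈ B) := by
    ext B; simp
  rw [e2, measureReal_def, uniformOn_apply_finset, Finset.card_powersetCard, Finset.card_univ,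
    Fintype.card_fin]
  have e3 : Finset.powersetCard bc (Finset.univ : Finset (Fin m))
      ∩ Finset.univ.filter (fun B => k ∈ B)
      = {B ∈ Finset.powersetCard bc (Finset.univ : Finset (Fin m)) | k ∈ B} := by
    ext B; simp
  rw [e3, ENNReal.toReal_div, ENNReal.toReal_natCast, ENNReal.toReal_natCast,
    div_eq_div_iff hc.ne' hm.ne']
  have h' : (m : ℝ) * ({B ∈ Finset.powersetCard bc (Finset.univ : Finset (Fin m)) |
      k ∈ B}.card : ℝ) = m.choose bc * bc := by exact_mod_cast h
  linarith

variable {d m : ℕ} {Z Ξ : Type*} [MeasurableSpace Z] [MeasurableSpace Ξ] {p : Problem d m Z Ξ}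
  {bc b₂ b : ℕ}

lemma isProbabilityMeasure_sampleLaw [IsProbabilityMeasure p.lawZ]
    [∀ k, IsProbabilityMeasure (p.lawΞ k)] (hbm : bc ≤ m) :
    IsProbabilityMeasure (p.sampleLaw bc b₂ b) := by
  have := isProbabilityMeasure_indexLaw hbm
  unfold Problem.sampleLaw
  infer_instance

lemma ae_card_sampleLaw [IsProbabilityMeasure p.lawZ] [∀ k, IsProbabilityMeasure (p.lawΞ k)]
    (hbm : bc ≤ m) : ∀ᵐ w ∂p.sampleLaw bc b₂ b, w.1.card = bc := by
  have := isProbabilityMeasure_indexLaw hbm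
  have h : ∀ᵐ B ∂(uniformOn {B : Finset (Fin m) | B.card = bc}), B.card = bc :=
    ae_cond_mem (Set.toFinite _).measurableSet
  exact (measurePreserving_fst (μ := uniformOn {B : Finset (Fin m) | B.card = bc})
    (ν := ((Measure.pi fun k => Measure.pi fun _ : Fin b₂ => p.lawΞ k).prod
      (Measure.pi fun _ : Fin b => p.lawZ)))).quasiMeasurePreserving.ae h

lemma measurePreserving_objectiveBatch [IsProbabilityMeasure p.lawZ]
    [∀ k, IsProbabilityMeasure (p.lawΞ k)] (hbm : bc ≤ m) :
    MeasurePreserving (fun w : Sample m b₂ b Z Ξ => w.2.2) (p.sampleLaw bc b₂ b)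
      (Measure.pi fun _ => p.lawZ) := by
  have := isProbabilityMeasure_indexLaw hbm
  exact measurePreserving_snd.comp measurePreserving_snd

lemma integral_objectiveBatch [IsProbabilityMeasure p.lawZ]
    [∀ k, IsProbabilityMeasure (p.lawΞ k)] (hbm : bc ≤ m) {g : (Fin b → Z) → ℝ}
    (hg : Integrable g (Measure.pi fun _ => p.lawZ)) :
    Integrable (fun w : Sample m b₂ b Z Ξ => g w.2.2) (p.sampleLaw bc b₂ b) ∧
      ∫ w : Sample m b₂ b Z Ξ, g w.2.2 ∂p.sampleLaw bc b₂ b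
        = ∫ B, g B ∂(Measure.pi fun _ => p.lawZ) := by
  have hmp := measurePreserving_objectiveBatch (p := p) (b₂ := b₂) (b := b) hbm
  refine ⟨hmp.integrable_comp_of_integrable hg, ?_⟩
  rw [← hmp.map_eq, integral_map hmp.measurable.aemeasurable]
  rw [hmp.map_eq]
  exact hg.aestronglyMeasurable

lemma measurePreserving_constraintBatch [IsProbabilityMeasure p.lawZ]
    [∀ k, IsProbabilityMeasure (p.lawΞ k)] (k : Fin m) :
    MeasurePreserving (fun v : (Fin m → Fin b₂ → Ξ) × (Fin b → Z) => v.1 k)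
      ((Measure.pi fun k => Measure.pi fun _ : Fin b₂ => p.lawΞ k).prod
      (Measure.pi fun _ : Fin b => p.lawZ)) (Measure.pi fun _ => p.lawΞ k) :=
  (measurePreserving_eval (fun k => Measure.pi fun _ : Fin b₂ => p.lawΞ k) k).comp
    measurePreserving_fst

/-- A function of the index set and a function of one mini-batch are independent. -/
lemma integral_index_smul [IsProbabilityMeasure p.lawZ]
    [∀ k, IsProbabilityMeasure (p.lawΞ k)] (hbm : bc ≤ m) (k : Fin m)
    (φ : Finset (Fin m) → ℝ) {g : (Fin b₂ → Ξ) → ℝ}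
    (hg : Integrable g (Measure.pi fun _ => p.lawΞ k)) :
    Integrable (fun w : Sample m b₂ b Z Ξ => φ w.1 * g (w.2.1 k)) (p.sampleLaw bc b₂ b) ∧
      ∫ w : Sample m b₂ b Z Ξ, φ w.1 * g (w.2.1 k) ∂p.sampleLaw bc b₂ b
        = (∫ B, φ B ∂(uniformOn {B : Finset (Fin m) | B.card = bc}))
          * ∫ B, g B ∂(Measure.pi fun _ => p.lawΞ k) := by
  have := isProbabilityMeasure_indexLaw hbm
  have hmp := measurePreserving_constraintBatch (p := p) (b₂ := b₂) (b := b) k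
  have hgi : Integrable (fun v : (Fin m → Fin b₂ → Ξ) × (Fin b → Z) => g (v.1 k))
      ((Measure.pi fun k => Measure.pi fun _ : Fin b₂ => p.lawΞ k).prod
        (Measure.pi fun _ : Fin b => p.lawZ)) := hmp.integrable_comp_of_integrable hg
  refine ⟨Integrable.mul_prod (f := φ) Integrable.of_finite hgi, ?_⟩
  have h1 : ∫ v, g (v.1 k) ∂((Measure.pi fun k => Measure.pi fun _ : Fin b₂ => p.lawΞ k).prod
        (Measure.pi fun _ : Fin b => p.lawZ)) = ∫ B, g B ∂(Measure.pi fun _ => p.lawΞ k) := by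
    rw [← hmp.map_eq, integral_map hmp.measurable.aemeasurable]
    rw [hmp.map_eq]
    exact hg.aestronglyMeasurable
  rw [← h1]
  exact integral_prod_mul φ
    (fun v : (Fin m → Fin b₂ → Ξ) × (Fin b → Z) => g (v.1 k))

end SampleLaw

/-! ### One iteration -/

section Step

variable {d m : ℕ} {Z Ξ : Type*} [MeasurableSpace Z] [MeasurableSpace Ξ] {p : Problem d m Z Ξ}
  {ρ₀ ρ₁ : ℝ} {L_F L_h : ℝ≥0} {σ_f σ_h : ℝ} {b₂ b : ℕ} {a : Params}

/-- States carry the product Borel structure of their three components. -/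
instance : MeasurableSpace (State d m) :=
  MeasurableSpace.comap (fun s => (s.x, s.xprev, s.u)) inferInstance

lemma measurable_state_components :
    Measurable (fun s : State d m => (s.x, s.xprev, s.u)) :=
  comap_measurable _

lemma measurable_state_x : Measurable (fun s : State d m => s.x) :=
  measurable_state_components.fst

lemma measurable_state_xprev : Measurable (fun s : State d m => s.xprev) :=
  measurable_state_components.snd.fst

lemma measurable_state_u (k : Fin m) : Measurable (fun s : State d m => s.u k) :=
  (measurable_pi_apply k).comp measurable_state_components.snd.snd

/-- The stochastic direction `G₁ + G₂` of one iteration. -/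
noncomputable def Problem.direction (p : Problem d m Z Ξ) (a : Params) (s : State d m)
    (w : Sample m b₂ b Z Ξ) : E d :=
  batchMean (p.df s.x) w.2.2 +
    (a.β / a.bc) • ∑ k ∈ w.1, a.hinge' (s.u k) • batchMean (p.dh k s.x) (w.2.1 k)

lemma Problem.step_x (s : State d m) (w : Sample m b₂ b Z Ξ) :
    (p.step a s w).x = s.x - a.η • p.direction a s w := rfl

lemma Problem.step_xprev (s : State d m) (w : Sample m b₂ b Z Ξ) :
    (p.step a s w).xprev = s.x := rfl

lemma measurable_uncurry_batchMean {α V X : Type*} [MeasurableSpace α] [MeasurableSpace X]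
    [NormedAddCommGroup V] [NormedSpace ℝ V] [MeasurableSpace V] [BorelSpace V]
    [SecondCountableTopology V] {b : ℕ} {T : Type*} [MeasurableSpace T] {g : X → α → V}
    (hg : Measurable (Function.uncurry g)) {x : T → X} {B : T → Fin b → α} (hx : Measurable x)
    (hB : Measurable B) : Measurable fun z => batchMean (g (x z)) (B z) := by
  unfold batchMean
  refine (Finset.measurable_fun_sum _ fun j _ => ?_).const_smul _
  exact hg.comp (hx.prodMk ((measurable_pi_apply j).comp hB))

lemma measurableSet_mem {T : Type*} [MeasurableSpace T] {B : T → Finset (Fin m)}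
    (hB : Measurable B) (k : Fin m) : MeasurableSet {z | k ∈ B z} :=
  hB (t := {B : Finset (Fin m) | k ∈ B}) (Set.toFinite _).measurableSet

lemma Problem.Assumptions.measurable_direction (A : p.Assumptions ρ₀ ρ₁ L_F L_h σ_f σ_h)
    (hh : Measurable a.hinge') {T : Type*} [MeasurableSpace T] {s : T → State d m}
    {w : T → Sample m b₂ b Z Ξ} (hs : Measurable s) (hw : Measurable w) :
    Measurable fun z => p.direction a (s z) (w z) := by
  have hx : Measurable fun z => (s z).x := measurable_state_x.comp hs
  unfold Problem.direction
  refine (measurable_uncurry_batchMean A.measurable_df hx hw.snd.snd).add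
    (Measurable.fun_const_smul ?_ _)
  have e : ∀ z, ∑ k ∈ (w z).1, a.hinge' ((s z).u k) • batchMean (p.dh k (s z).x) ((w z).2.1 k)
      = ∑ k, if k ∈ (w z).1 then
          a.hinge' ((s z).u k) • batchMean (p.dh k (s z).x) ((w z).2.1 k) else 0 := fun z => by
    rw [Finset.sum_ite_mem, Finset.univ_inter]
  simp_rw [e]
  refine Finset.measurable_fun_sum _ fun k _ => ?_
  refine Measurable.ite (measurableSet_mem hw.fst k) (Measurable.fun_smul ?_ ?_)
    measurable_const
  · exact hh.comp ((measurable_state_u k).comp hs)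
  · exact measurable_uncurry_batchMean (A.measurable_dh k) hx
      ((measurable_pi_apply k).comp hw.snd.fst)

lemma Problem.Assumptions.measurable_step (A : p.Assumptions ρ₀ ρ₁ L_F L_h σ_f σ_h)
    (hh : Measurable a.hinge') {T : Type*} [MeasurableSpace T] {s : T → State d m}
    {w : T → Sample m b₂ b Z Ξ} (hs : Measurable s) (hw : Measurable w) :
    Measurable fun z => p.step a (s z) (w z) := by
  have hx : Measurable fun z => (s z).x := measurable_state_x.comp hs
  have hxp : Measurable fun z => (s z).xprev := measurable_state_xprev.comp hs
  refine measurable_comap_iff.mpr ((Measurable.prodMk ?_ (Measurable.prodMk hx ?_)))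
  · exact hx.sub ((A.measurable_direction hh hs hw).const_smul a.η)
  · refine measurable_pi_lambda _ fun k => ?_
    have hu : Measurable fun z => (s z).u k := (measurable_state_u k).comp hs
    have hB : Measurable fun z => (w z).2.1 k := (measurable_pi_apply k).comp hw.snd.fst
    have h1 := measurable_uncurry_batchMean (A.measurable_h k) hx hB
    have h2 := measurable_uncurry_batchMean (A.measurable_h k) hxp hB
    exact Measurable.ite (measurableSet_mem hw.fst k)
      (((hu.const_mul _).add (h1.const_mul _)).add ((h1.sub h2).const_mul _)) hu

/-- The second moment of the direction is bounded uniformly over all states. -/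
lemma Problem.Assumptions.secondMoment_direction (A : p.Assumptions ρ₀ ρ₁ L_F L_h σ_f σ_h)
    (hh : ∀ z, IsSubgrad hinge z (a.hinge' z)) (hbc : 1 ≤ a.bc) (hbm : a.bc ≤ m) (hb₂ : 1 ≤ b₂)
    (hb : 1 ≤ b) (s : State d m) :
    SecondMomentLE (p.sampleLaw a.bc b₂ b) (p.direction a s)
      (4 * (σ_f ^ 2 + L_F ^ 2) + 4 * d * L_h ^ 2 * a.β ^ 2) := by
  have := A.probZ
  have := A.probΞ
  have hc0 : (0 : ℝ) < a.bc := by positivity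
  have hm0 : (0 : ℝ) < m := by exact_mod_cast hbc.trans hbm
  have hmeas : Measurable fun w : Sample m b₂ b Z Ξ => p.direction a s w :=
    A.measurable_direction (monotone_of_isSubgrad_hinge hh).measurable measurable_const measurable_id
  obtain ⟨h1i, h1le⟩ := (A.secondMoment_df s.x).batchMean hb
    (A.measurable_df.of_uncurry_left (x := s.x)).aestronglyMeasurable
  have h2 := fun k => (A.secondMoment_dh k s.x).batchMean hb₂
    ((A.measurable_dh k).of_uncurry_left (x := s.x)).aestronglyMeasurable
  obtain ⟨hG1, hG1'⟩ := integral_objectiveBatch (p := p) (b₂ := b₂) hbm h1i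
  rw [← hG1'] at h1le
  have hk := fun k => integral_index_smul (p := p) (b := b) hbm k
    (fun B => if k ∈ B then (1 : ℝ) else 0) (h2 k).1
  set U : Sample m b₂ b Z Ξ → ℝ := fun w => 2 * ‖batchMean (p.df s.x) w.2.2‖ ^ 2
    + 2 * (a.β ^ 2 / a.bc * ∑ k, (if k ∈ w.1 then (1 : ℝ) else 0)
        * ‖batchMean (p.dh k s.x) (w.2.1 k)‖ ^ 2) with hU
  have hi2 : Integrable (fun w : Sample m b₂ b Z Ξ => a.β ^ 2 / a.bc * ∑ k,
      (if k ∈ w.1 then (1 : ℝ) else 0) * ‖batchMean (p.dh k s.x) (w.2.1 k)‖ ^ 2)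
      (p.sampleLaw a.bc b₂ b) := (integrable_finsetSum _ fun k _ => (hk k).1).const_mul _
  have hUi : Integrable U (p.sampleLaw a.bc b₂ b) := (hG1.const_mul 2).add (hi2.const_mul 2)
  have hpt : ∀ᵐ w ∂p.sampleLaw a.bc b₂ b, ‖p.direction a s w‖ ^ 2 ≤ U w := by
    filter_upwards [ae_card_sampleLaw (p := p) (b₂ := b₂) (b := b) hbm] with w hw
    refine (norm_add_sq_le_two _ _).trans (add_le_add le_rfl ?_)
    refine mul_le_mul_of_nonneg_left ?_ zero_le_two
    have h3 := norm_sum_sq_le w.1 fun k =>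
      a.hinge' (s.u k) • batchMean (p.dh k s.x) (w.2.1 k)
    have h4 : ∑ k ∈ w.1, ‖a.hinge' (s.u k) • batchMean (p.dh k s.x) (w.2.1 k)‖ ^ 2
        ≤ ∑ k ∈ w.1, ‖batchMean (p.dh k s.x) (w.2.1 k)‖ ^ 2 :=
      Finset.sum_le_sum fun k _ => by
        refine pow_le_pow_left₀ (norm_nonneg _) ?_ 2
        rw [norm_smul, Real.norm_of_nonneg (hh _).hinge_nonneg]
        exact mul_le_of_le_one_left (norm_nonneg _) (hh _).hinge_le_one
    have h5 : ∑ k ∈ w.1, ‖batchMean (p.dh k s.x) (w.2.1 k)‖ ^ 2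
        = ∑ k, (if k ∈ w.1 then (1 : ℝ) else 0)
          * ‖batchMean (p.dh k s.x) (w.2.1 k)‖ ^ 2 := by
      simp only [ite_mul, one_mul, zero_mul]
      rw [Finset.sum_ite_mem, Finset.univ_inter]
    rw [← h5, norm_smul, mul_pow, Real.norm_eq_abs, sq_abs]
    rw [hw] at h3
    calc (a.β / a.bc) ^ 2 * _ ≤ (a.β / a.bc) ^ 2 * (a.bc *
          ∑ k ∈ w.1, ‖batchMean (p.dh k s.x) (w.2.1 k)‖ ^ 2) := by
          gcongr
          exact h3.trans (by gcongr)
      _ = _ := by field_simp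
  have hint : Integrable (fun w => ‖p.direction a s w‖ ^ 2) (p.sampleLaw a.bc b₂ b) :=
    hUi.mono' (hmeas.norm.pow_const 2).aestronglyMeasurable (by
      filter_upwards [hpt] with w hw
      rwa [Real.norm_of_nonneg (by positivity)])
  refine ⟨hint, (integral_mono_ae hint hUi hpt).trans ?_⟩
  rw [hU, integral_add (hG1.const_mul 2) (hi2.const_mul 2), integral_const_mul,
    integral_const_mul, integral_const_mul, integral_finsetSum _ fun k _ => (hk k).1]
  have hsum : ∑ k, ∫ w : Sample m b₂ b Z Ξ, (if k ∈ w.1 then (1 : ℝ) else 0)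
        * ‖batchMean (p.dh k s.x) (w.2.1 k)‖ ^ 2 ∂p.sampleLaw a.bc b₂ b
      ≤ a.bc * (2 * d * L_h ^ 2) := by
    calc _ ≤ ∑ _k : Fin m, (a.bc : ℝ) / m * (2 * d * L_h ^ 2) := by
          refine Finset.sum_le_sum fun k _ => ?_
          rw [(hk k).2, integral_mem_indexLaw hbc hbm]
          gcongr
          exact (h2 k).2
      _ = _ := by
          rw [Finset.sum_const, Finset.card_univ, Fintype.card_fin, nsmul_eq_mul]
          field_simp
  have h6 : a.β ^ 2 / a.bc * _ ≤ a.β ^ 2 / a.bc * (a.bc * (2 * d * L_h ^ 2)) :=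
    mul_le_mul_of_nonneg_left hsum (by positivity)
  have h7 : a.β ^ 2 / a.bc * (a.bc * (2 * d * L_h ^ 2)) = 2 * d * L_h ^ 2 * a.β ^ 2 := by
    field_simp
  linarith

/-- The direction is an unbiased estimate of a subgradient of the penalty function, except that
the hinge function is differentiated at the estimates `u_k` and not at `h_k(x)`. -/
lemma Problem.Assumptions.integral_inner_direction (A : p.Assumptions ρ₀ ρ₁ L_F L_h σ_f σ_h)
    (hbc : 1 ≤ a.bc) (hbm : a.bc ≤ m) (hb₂ : 1 ≤ b₂) (hb : 1 ≤ b) (s : State d m) (z : E d) :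
    Integrable (fun w : Sample m b₂ b Z Ξ => inner ℝ z (p.direction a s w))
        (p.sampleLaw a.bc b₂ b) ∧
      ∫ w : Sample m b₂ b Z Ξ, inner ℝ z (p.direction a s w) ∂p.sampleLaw a.bc b₂ b
        = inner ℝ z ((∫ ζ, p.df s.x ζ ∂p.lawZ)
          + (a.β / m) • ∑ k, a.hinge' (s.u k) • ∫ ξ, p.dh k s.x ξ ∂p.lawΞ k) := by
  have := A.probZ
  have := A.probΞ
  have hc0 : (0 : ℝ) < a.bc := by positivity
  have hm0 : (0 : ℝ) < m := by exact_mod_cast hbc.trans hbm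
  have h1 := integrable_batchMean (b := b) (A.integrable_df s.x)
  have h1z : Integrable (fun B : Fin b → Z => inner ℝ z (batchMean (p.df s.x) B))
      (Measure.pi fun _ => p.lawZ) := h1.const_inner z
  obtain ⟨hG1, hG1'⟩ := integral_objectiveBatch (p := p) (b₂ := b₂) hbm h1z
  rw [integral_inner h1, integral_batchMean hb (A.integrable_df s.x)] at hG1'
  have h2 := fun k => integrable_batchMean (b := b₂) (A.integrable_dh k s.x)
  have h2z : ∀ k, Integrable (fun B : Fin b₂ → Ξ =>
      a.hinge' (s.u k) * inner ℝ z (batchMean (p.dh k s.x) B))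
      (Measure.pi fun _ => p.lawΞ k) := fun k => ((h2 k).const_inner z).const_mul _
  have hk := fun k => integral_index_smul (p := p) (b := b) hbm k
    (fun B => if k ∈ B then (1 : ℝ) else 0) (h2z k)
  have e : ∀ w : Sample m b₂ b Z Ξ, inner ℝ z (p.direction a s w)
      = inner ℝ z (batchMean (p.df s.x) w.2.2) + a.β / a.bc * ∑ k,
        (if k ∈ w.1 then (1 : ℝ) else 0)
          * (a.hinge' (s.u k) * inner ℝ z (batchMean (p.dh k s.x) (w.2.1 k))) := fun w => by
    simp only [ite_mul, one_mul, zero_mul]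
    rw [Finset.sum_ite_mem, Finset.univ_inter, Problem.direction, inner_add_right,
      inner_smul_right, inner_sum]
    simp only [inner_smul_right]
  simp_rw [e]
  have hi2 := (integrable_finsetSum Finset.univ fun k _ => (hk k).1).const_mul (a.β / a.bc)
  refine ⟨hG1.add hi2, ?_⟩
  rw [integral_add hG1 hi2, integral_const_mul, integral_finsetSum _ fun k _ => (hk k).1, hG1',
    inner_add_right, inner_smul_right, inner_sum]
  congr 1
  rw [Finset.mul_sum, Finset.mul_sum]
  refine Finset.sum_congr rfl fun k _ => ?_
  rw [(hk k).2, integral_mem_indexLaw hbc hbm, integral_const_mul, integral_inner (h2 k),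
    integral_batchMean hb₂ (A.integrable_dh k s.x), inner_smul_right]
  field_simp

end Step

section OneStep

variable {d m : ℕ} {Z Ξ : Type*} [MeasurableSpace Z] [MeasurableSpace Ξ] {p : Problem d m Z Ξ}
  {ρ₀ ρ₁ : ℝ} {L_F L_h : ℝ≥0} {σ_f σ_h : ℝ} {b₂ b : ℕ} {a : Params}

/-- The scalar inequality behind the error recursion of the estimators. Here `κ` is the excess of
`γ₂'` over `1 - γ₂`; its value makes the terms in `e * D` cancel between the sampled and the
unsampled case. -/
lemma estimator_error_algebra {q γ κ e D D₂ v n : ℝ} (hq0 : 0 < q) (hq1 : q ≤ 1) (hγ0 : 0 ≤ γ)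
    (hγ1 : γ ≤ 1 / 2) (hκ : κ * (q * (1 - γ)) = 1 - q) (hD : D ^ 2 ≤ D₂) (hn : 1 ≤ n) :
    q * (((1 - γ) * e + κ * D) ^ 2 + (2 * γ ^ 2 * v + 2 * (κ + 1 - γ) ^ 2 * D₂) / n)
        + (1 - q) * (e - D) ^ 2
      ≤ (1 - q * γ) * e ^ 2 + 23 / q * D₂ + 2 * q * γ ^ 2 * v / n := by
  have hD0 : 0 ≤ D₂ := (sq_nonneg D).trans hD
  have hκ0 : 0 ≤ κ := by
    by_contra! h
    have : 0 < q * (1 - γ) := mul_pos hq0 (by linarith)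
    nlinarith
  have hκq : κ * q ≤ 2 := by nlinarith [mul_nonneg hκ0 hq0.le]
  have hκ1 : (κ + 1 - γ) * q ≤ 3 := by nlinarith
  have hκ10 : 0 ≤ (κ + 1 - γ) * q := mul_nonneg (by linarith) hq0.le
  have h1 : q * ((1 - γ) * e + κ * D) ^ 2 + (1 - q) * (e - D) ^ 2
      = (q * (1 - γ) ^ 2 + (1 - q)) * e ^ 2 + (q * κ ^ 2 + (1 - q)) * D ^ 2
        + 2 * e * D * (κ * (q * (1 - γ)) - (1 - q)) := by ring
  rw [hκ, sub_self, mul_zero, add_zero] at h1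
  have h2 : (q * (1 - γ) ^ 2 + (1 - q)) * e ^ 2 ≤ (1 - q * γ) * e ^ 2 := by
    refine mul_le_mul_of_nonneg_right ?_ (sq_nonneg e)
    nlinarith [mul_nonneg hq0.le hγ0]
  have h3 : (q * κ ^ 2 + (1 - q)) * D ^ 2 ≤ 5 / q * D₂ := by
    refine mul_le_mul ?_ hD (sq_nonneg D) (by positivity)
    rw [le_div_iff₀ hq0]
    have : (κ * q) ^ 2 ≤ 2 ^ 2 := pow_le_pow_left₀ (by positivity) hκq 2
    nlinarith
  have h4 : q * (2 * (κ + 1 - γ) ^ 2 * D₂ / n) ≤ 18 / q * D₂ := by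
    have h5 : 2 * (κ + 1 - γ) ^ 2 * D₂ / n ≤ 2 * (κ + 1 - γ) ^ 2 * D₂ :=
      div_le_self (by positivity) hn
    have h6 : ((κ + 1 - γ) * q) ^ 2 ≤ 3 ^ 2 := pow_le_pow_left₀ hκ10 hκ1 2
    calc q * (2 * (κ + 1 - γ) ^ 2 * D₂ / n) ≤ q * (2 * (κ + 1 - γ) ^ 2 * D₂) := by gcongr
      _ = 2 * ((κ + 1 - γ) * q) ^ 2 / q * D₂ := by field_simp
      _ ≤ 18 / q * D₂ := by gcongr; linarith
  have h7 : q * (((1 - γ) * e + κ * D) ^ 2 + (2 * γ ^ 2 * v + 2 * (κ + 1 - γ) ^ 2 * D₂) / n)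
      = q * ((1 - γ) * e + κ * D) ^ 2 + 2 * q * γ ^ 2 * v / n
        + q * (2 * (κ + 1 - γ) ^ 2 * D₂ / n) := by ring
  have h8 : 23 / q * D₂ = 5 / q * D₂ + 18 / q * D₂ := by ring
  rw [h7, h8]
  linarith

/-- The centred noise in the update of one estimator by a single sample. -/
lemma Problem.Assumptions.estimator_noise (A : p.Assumptions ρ₀ ρ₁ L_F L_h σ_f σ_h) (k : Fin m)
    (x y : E d) (γ γ' : ℝ) :
    Measurable (fun ξ => γ * (p.h k x ξ - p.H k x)
        + γ' * (p.h k x ξ - p.h k y ξ - (p.H k x - p.H k y))) ∧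
      ∫ ξ, (γ * (p.h k x ξ - p.H k x)
        + γ' * (p.h k x ξ - p.h k y ξ - (p.H k x - p.H k y))) ∂p.lawΞ k = 0 ∧
      SecondMomentLE (p.lawΞ k) (fun ξ => γ * (p.h k x ξ - p.H k x)
        + γ' * (p.h k x ξ - p.h k y ξ - (p.H k x - p.H k y)))
        (2 * γ ^ 2 * σ_h ^ 2 + 2 * γ' ^ 2 * (L_h ^ 2 * ‖x - y‖ ^ 2)) := by
  have := A.probΞ k
  have hmx : Measurable (p.h k x) := (A.measurable_h k).of_uncurry_left
  have hmy : Measurable (p.h k y) := (A.measurable_h k).of_uncurry_left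
  have hix := A.integrable_h k x
  have hiy := A.integrable_h k y
  have hixy : Integrable (fun ξ => p.h k x ξ - p.h k y ξ) (p.lawΞ k) := hix.sub hiy
  have hmeas : Measurable (fun ξ => γ * (p.h k x ξ - p.H k x)
        + γ' * (p.h k x ξ - p.h k y ξ - (p.H k x - p.H k y))) :=
    ((hmx.sub_const _).const_mul _).add (((hmx.sub hmy).sub_const _).const_mul _)
  have hmean : ∫ ξ, (p.h k x ξ - p.h k y ξ) ∂p.lawΞ k = p.H k x - p.H k y :=
    integral_sub hix hiy
  refine ⟨hmeas, ?_, ?_⟩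
  · have h1 : Integrable (fun ξ => γ * (p.h k x ξ - p.H k x)) (p.lawΞ k) :=
      (hix.sub (integrable_const _)).const_mul _
    have h2 : Integrable (fun ξ => γ' * (p.h k x ξ - p.h k y ξ - (p.H k x - p.H k y)))
        (p.lawΞ k) := (hixy.sub (integrable_const _)).const_mul _
    rw [integral_add h1 h2, integral_const_mul, integral_const_mul,
      integral_sub hix (integrable_const _), integral_sub hixy (integrable_const _), hmean]
    simp [Problem.H]
  · obtain ⟨hvi, hvle⟩ := A.variance_h k x
    obtain ⟨hli, hlle⟩ := A.meanSquareLipschitz_h k x y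
    simp only [Real.norm_eq_abs, sq_abs] at hvi hvle hli hlle
    set D := p.H k x - p.H k y with hD
    have hDexp : ∀ ξ, (p.h k x ξ - p.h k y ξ - D) ^ 2
        = (p.h k x ξ - p.h k y ξ) ^ 2 - 2 * D * (p.h k x ξ - p.h k y ξ) + D ^ 2 := fun ξ => by
      ring
    have hi1 : Integrable (fun ξ => (p.h k x ξ - p.h k y ξ) ^ 2
        - 2 * D * (p.h k x ξ - p.h k y ξ)) (p.lawΞ k) := hli.sub (hixy.const_mul _)
    have hci : Integrable (fun ξ => (p.h k x ξ - p.h k y ξ - D) ^ 2) (p.lawΞ k) := by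
      simp_rw [hDexp]
      exact hi1.add (integrable_const _)
    have hcle : ∫ ξ, (p.h k x ξ - p.h k y ξ - D) ^ 2 ∂p.lawΞ k ≤ L_h ^ 2 * ‖x - y‖ ^ 2 := by
      simp_rw [hDexp]
      rw [integral_add hi1 (integrable_const _), integral_sub hli (hixy.const_mul _),
        integral_const_mul, hmean]
      simp only [integral_const, probReal_univ, smul_eq_mul, one_mul]
      nlinarith [sq_nonneg D]
    have hpt : ∀ ξ, ‖γ * (p.h k x ξ - p.H k x) + γ' * (p.h k x ξ - p.h k y ξ - D)‖ ^ 2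
        ≤ 2 * γ ^ 2 * (p.h k x ξ - p.H k x) ^ 2
          + 2 * γ' ^ 2 * (p.h k x ξ - p.h k y ξ - D) ^ 2 := fun ξ => by
      have := norm_add_sq_le_two (γ * (p.h k x ξ - p.H k x)) (γ' * (p.h k x ξ - p.h k y ξ - D))
      simp only [Real.norm_eq_abs, sq_abs, mul_pow] at this ⊢
      linarith
    have hui := (hvi.const_mul (2 * γ ^ 2)).add (hci.const_mul (2 * γ' ^ 2))
    have hint : Integrable (fun ξ =>
        ‖γ * (p.h k x ξ - p.H k x) + γ' * (p.h k x ξ - p.h k y ξ - D)‖ ^ 2) (p.lawΞ k) :=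
      hui.mono' (hmeas.norm.pow_const 2).aestronglyMeasurable
        (Filter.Eventually.of_forall fun ξ => by
          rw [Real.norm_of_nonneg (by positivity)]; exact hpt ξ)
    refine ⟨hint, (integral_mono hint hui hpt).trans ?_⟩
    simp only [Pi.add_apply]
    rw [integral_add (hvi.const_mul _) (hci.const_mul _), integral_const_mul, integral_const_mul]
    gcongr

/-- Error recursion of the estimator `u_k`, in mean square and conditionally on the state. -/
lemma Problem.Assumptions.secondMoment_estimator_step
    (A : p.Assumptions ρ₀ ρ₁ L_F L_h σ_f σ_h) (hbc : 1 ≤ a.bc) (hbm : a.bc ≤ m) (hb₂ : 1 ≤ b₂)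
    (hγ0 : 0 ≤ a.γ) (hγ1 : a.γ ≤ 1 / 2) (s : State d m) (k : Fin m) :
    Integrable (fun w => ((p.step (b₂ := b₂) (b := b) a s w).u k - p.H k s.x) ^ 2)
        (p.sampleLaw a.bc b₂ b) ∧
      ∫ w, ((p.step (b₂ := b₂) (b := b) a s w).u k - p.H k s.x) ^ 2 ∂p.sampleLaw a.bc b₂ b
        ≤ (1 - a.bc / m * a.γ) * (s.u k - p.H k s.xprev) ^ 2
          + 23 / (a.bc / m) * (L_h ^ 2 * ‖s.x - s.xprev‖ ^ 2)
          + 2 * (a.bc / m) * a.γ ^ 2 * σ_h ^ 2 / b₂ := by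
  have := A.probZ
  have := A.probΞ
  have := isProbabilityMeasure_indexLaw hbm
  have hc0 : (0 : ℝ) < a.bc := by positivity
  have hm0 : (0 : ℝ) < m := by exact_mod_cast hbc.trans hbm
  have hb0 : (b₂ : ℝ) ≠ 0 := by positivity
  obtain ⟨hgm, hg0, hg2⟩ := A.estimator_noise k s.x s.xprev a.γ (a.γ' m)
  set g : Ξ → ℝ := fun ξ => a.γ * (p.h k s.x ξ - p.H k s.x)
        + a.γ' m * (p.h k s.x ξ - p.h k s.xprev ξ - (p.H k s.x - p.H k s.xprev)) with hg
  set κ := ((m : ℝ) - a.bc) / (a.bc * (1 - a.γ)) with hκ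
  have hγ' : a.γ' m = κ + 1 - a.γ := rfl
  set e := s.u k - p.H k s.xprev with he
  set D := p.H k s.x - p.H k s.xprev with hD
  obtain ⟨hbi, hble⟩ := secondMoment_const_add_batchMean hb₂ hgm hg2 hg0
    ((1 - a.γ) * e + κ * D)
  simp only [Real.norm_eq_abs, sq_abs] at hbi hble
  have hpt : ∀ w : Sample m b₂ b Z Ξ, ((p.step a s w).u k - p.H k s.x) ^ 2
      = (if k ∈ w.1 then (1 : ℝ) else 0)
          * ((1 - a.γ) * e + κ * D + batchMean g (w.2.1 k)) ^ 2
        + (if k ∈ w.1 then (0 : ℝ) else 1) * (e - D) ^ 2 := fun w => by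
    by_cases hk : k ∈ w.1
    · simp only [Problem.step, hk, if_true, one_mul, zero_mul, add_zero]
      congr 1
      have h1 : batchMean g (w.2.1 k) = a.γ * (batchMean (p.h k s.x) (w.2.1 k) - p.H k s.x)
          + a.γ' m * (batchMean (p.h k s.x) (w.2.1 k) - batchMean (p.h k s.xprev) (w.2.1 k) - D) := by
        simp only [batchMean, hg, smul_eq_mul, Finset.sum_add_distrib, ← Finset.mul_sum,
          Finset.sum_sub_distrib, Finset.sum_const, Finset.card_univ, Fintype.card_fin,
          nsmul_eq_mul]
        field_simp
      rw [h1, hγ', he, hD]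
      ring
    · simp only [Problem.step, hk, if_false, one_mul, zero_mul, zero_add]
      congr 1
      rw [he, hD]
      ring
  simp_rw [hpt]
  obtain ⟨hi1, hI1⟩ := integral_index_smul (p := p) (b := b) hbm k
    (fun B => if k ∈ B then (1 : ℝ) else 0) hbi
  obtain ⟨hi2, hI2⟩ := integral_index_smul (p := p) (b₂ := b₂) (b := b) hbm k
    (fun B => if k ∈ B then (0 : ℝ) else 1) (g := fun _ => (e - D) ^ 2) (integrable_const _)
  refine ⟨hi1.add hi2, ?_⟩
  have hcompl : ∫ B : Finset (Fin m), (if k ∈ B then (0 : ℝ) else 1)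
      ∂(uniformOn {B : Finset (Fin m) | B.card = a.bc}) = 1 - a.bc / m := by
    rw [← integral_mem_indexLaw hbc hbm k]
    have : ∀ B : Finset (Fin m), (if k ∈ B then (0 : ℝ) else 1)
        = 1 - if k ∈ B then (1 : ℝ) else 0 := fun B => by split_ifs <;> simp
    simp_rw [this]
    rw [integral_sub (integrable_const _) Integrable.of_finite]
    simp
  rw [integral_add hi1 hi2, hI1, hI2, hcompl, integral_mem_indexLaw hbc hbm]
  simp only [integral_const, probReal_univ, smul_eq_mul, one_mul]
  have hq0 : (0 : ℝ) < a.bc / m := by positivity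
  have hq1 : (a.bc : ℝ) / m ≤ 1 := by
    rw [div_le_one hm0]; exact_mod_cast hbm
  have hκq : κ * (a.bc / m * (1 - a.γ)) = 1 - a.bc / m := by
    have : 1 - a.γ ≠ 0 := by linarith
    rw [hκ]
    field_simp
  have hD2 : D ^ 2 ≤ L_h ^ 2 * ‖s.x - s.xprev‖ ^ 2 := by
    have h1 := (A.lipschitz_H k).norm_sub_le s.x s.xprev
    rw [← sq_abs, ← mul_pow]
    exact pow_le_pow_left₀ (abs_nonneg _) h1 2
  refine le_trans ?_ (estimator_error_algebra (e := e) hq0 hq1 hγ0 hγ1 hκq hD2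
    (show (1 : ℝ) ≤ b₂ by exact_mod_cast hb₂))
  rw [← hγ']
  gcongr

lemma Problem.Assumptions.secondMoment_move (A : p.Assumptions ρ₀ ρ₁ L_F L_h σ_f σ_h)
    (hh : ∀ z, IsSubgrad hinge z (a.hinge' z)) (hbc : 1 ≤ a.bc) (hbm : a.bc ≤ m) (hb₂ : 1 ≤ b₂)
    (hb : 1 ≤ b) (s : State d m) :
    Integrable (fun w => ‖(p.step (b₂ := b₂) (b := b) a s w).x
        - (p.step (b₂ := b₂) (b := b) a s w).xprev‖ ^ 2) (p.sampleLaw a.bc b₂ b) ∧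
      ∫ w, ‖(p.step (b₂ := b₂) (b := b) a s w).x
        - (p.step (b₂ := b₂) (b := b) a s w).xprev‖ ^ 2 ∂p.sampleLaw a.bc b₂ b
        ≤ a.η ^ 2 * (4 * (σ_f ^ 2 + L_F ^ 2) + 4 * d * L_h ^ 2 * a.β ^ 2) := by
  obtain ⟨hi, hle⟩ := A.secondMoment_direction hh hbc hbm hb₂ hb s
  have e : ∀ w : Sample m b₂ b Z Ξ, ‖(p.step a s w).x - (p.step a s w).xprev‖ ^ 2
      = a.η ^ 2 * ‖p.direction a s w‖ ^ 2 := fun w => by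
    rw [Problem.step_x, Problem.step_xprev, sub_sub_cancel_left, norm_neg, norm_smul, mul_pow,
      Real.norm_eq_abs, sq_abs]
  simp_rw [e]
  refine ⟨hi.const_mul _, ?_⟩
  rw [integral_const_mul]
  gcongr

/-- Expected decrease of the Moreau envelope in one iteration, conditionally on the state. -/
lemma Problem.Assumptions.moreauEnv_step (A : p.Assumptions ρ₀ ρ₁ L_F L_h σ_f σ_h)
    (hρ₀ : 0 < ρ₀) (hρ₁ : 0 ≤ ρ₁) (hβ : 0 ≤ a.β)
    (hh : ∀ z, IsSubgrad hinge z (a.hinge' z)) (hbc : 1 ≤ a.bc) (hbm : a.bc ≤ m) (hb₂ : 1 ≤ b₂)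
    (hb : 1 ≤ b) (hη : 0 ≤ a.η) {C : ℝ} (hC : ∀ x, C ≤ p.Phi a.β x) (s : State d m) :
    Integrable (fun w => moreauEnv (1 / (2 * (ρ₀ + ρ₁ * a.β))) (p.Phi a.β)
        (p.step (b₂ := b₂) (b := b) a s w).x - C) (p.sampleLaw a.bc b₂ b) ∧
      ∫ w, (moreauEnv (1 / (2 * (ρ₀ + ρ₁ * a.β))) (p.Phi a.β)
        (p.step (b₂ := b₂) (b := b) a s w).x - C) ∂p.sampleLaw a.bc b₂ b
        ≤ moreauEnv (1 / (2 * (ρ₀ + ρ₁ * a.β))) (p.Phi a.β) s.x - C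
          - a.η / 4 * ‖∇ (moreauEnv (1 / (2 * (ρ₀ + ρ₁ * a.β))) (p.Phi a.β)) s.x‖ ^ 2
          + 4 * (ρ₀ + ρ₁ * a.β) * a.η * (a.β / m * ∑ k, |s.u k - p.H k s.x|)
          + (ρ₀ + ρ₁ * a.β) * a.η ^ 2
            * (4 * (σ_f ^ 2 + L_F ^ 2) + 4 * d * L_h ^ 2 * a.β ^ 2) := by
  have := A.probZ
  have := A.probΞ
  have := isProbabilityMeasure_sampleLaw (p := p) (b₂ := b₂) (b := b) hbm
  set ρ := ρ₀ + ρ₁ * a.β with hρ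
  have hρ0 : 0 < ρ := by positivity
  have hQ := A.quadSupported_Phi hρ₁ hβ
  have hex : ∀ y, ∃ r, IsProx ρ (p.Phi a.β) y r := exists_isProx hρ0 (A.lipschitz_Phi hβ)
  obtain ⟨q, hq⟩ := hex s.x
  obtain ⟨hi, hle⟩ := A.secondMoment_direction hh hbc hbm hb₂ hb s
  obtain ⟨hii, hI⟩ := A.integral_inner_direction hbc hbm hb₂ hb s (q - s.x)
  have hdir := A.inner_direction_le hρ₁ hβ hh hq s.u
  rw [← hI] at hdir
  set M := 4 * (σ_f ^ 2 + L_F ^ 2) + 4 * d * L_h ^ 2 * a.β ^ 2 with hM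
  set env := moreauEnv (1 / (2 * ρ)) (p.Phi a.β) with henv
  have hlow : ∀ y, C ≤ env y := fun y => by
    obtain ⟨r, hr⟩ := hex y
    rw [henv, hr.moreauEnv_eq]
    have := hC r
    have : 0 ≤ ρ * ‖r - y‖ ^ 2 := by positivity
    linarith
  have hcont : Continuous env := continuous_iff_continuousAt.mpr fun y => by
    obtain ⟨r, hr⟩ := hex y
    exact (hr.hasGradientAt hρ0 hQ hex).continuousAt
  have hmeas : Measurable fun w : Sample m b₂ b Z Ξ => env (p.step a s w).x - C :=
    (hcont.measurable.comp (measurable_state_x.comp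
      (A.measurable_step (monotone_of_isSubgrad_hinge hh).measurable
        measurable_const measurable_id))).sub_const C
  have hpt : ∀ w : Sample m b₂ b Z Ξ, env (p.step a s w).x - C
      ≤ (env s.x - C) + 2 * ρ * a.η * inner ℝ (q - s.x) (p.direction a s w)
        + ρ * a.η ^ 2 * ‖p.direction a s w‖ ^ 2 := fun w => by
    obtain ⟨r, hr⟩ := hex (p.step a s w).x
    have h1 := hr.moreauEnv_le q
    have h2 := hq.moreauEnv_eq
    have e : q - (p.step a s w).x = (q - s.x) + a.η • p.direction a s w := by
      rw [Problem.step_x]; abel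
    rw [e, norm_add_sq_real, norm_smul, inner_smul_right, mul_pow, Real.norm_eq_abs,
      sq_abs] at h1
    rw [henv]
    linarith
  have hi1 : Integrable (fun w : Sample m b₂ b Z Ξ => (env s.x - C)
      + 2 * ρ * a.η * inner ℝ (q - s.x) (p.direction a s w)) (p.sampleLaw a.bc b₂ b) :=
    (integrable_const _).add (hii.const_mul _)
  have hi2 : Integrable (fun w : Sample m b₂ b Z Ξ =>
      ρ * a.η ^ 2 * ‖p.direction a s w‖ ^ 2) (p.sampleLaw a.bc b₂ b) := hi.const_mul _
  have hint : Integrable (fun w : Sample m b₂ b Z Ξ => env (p.step a s w).x - C)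
      (p.sampleLaw a.bc b₂ b) :=
    (hi1.add hi2).mono' hmeas.aestronglyMeasurable (Filter.Eventually.of_forall fun w => by
      rw [Real.norm_of_nonneg (sub_nonneg.mpr (hlow _))]; exact hpt w)
  refine ⟨hint, (integral_mono hint (hi1.add hi2) hpt).trans ?_⟩
  simp only [Pi.add_apply]
  rw [integral_add hi1 hi2, integral_add (integrable_const _) (hii.const_mul _),
    integral_const_mul, integral_const_mul]
  simp only [integral_const, probReal_univ, smul_eq_mul, one_mul]
  have hgrad : ‖∇ env s.x‖ = 2 * ρ * ‖q - s.x‖ := hq.norm_gradient hρ0 hQ hex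
  have h3 := mul_le_mul_of_nonneg_left hdir (show 0 ≤ 2 * ρ * a.η by positivity)
  have h4 := mul_le_mul_of_nonneg_left hle (show 0 ≤ ρ * a.η ^ 2 by positivity)
  rw [hgrad]
  have e1 : 2 * ρ * a.η * (-(ρ / 2) * ‖q - s.x‖ ^ 2
      + 2 * a.β / m * ∑ k, |s.u k - p.H k s.x|)
      = -(a.η / 4 * (2 * ρ * ‖q - s.x‖) ^ 2)
        + 4 * ρ * a.η * (a.β / m * ∑ k, |s.u k - p.H k s.x|) := by ring
  rw [e1] at h3
  linarith

end OneStep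

/-! ### Trajectories -/

section Moments

variable {Ω : Type*} [MeasurableSpace Ω] {μ : Measure Ω} [IsProbabilityMeasure μ]

lemma integrable_abs_of_sq {f : Ω → ℝ} (hm : AEMeasurable f μ)
    (hi : Integrable (fun ω => f ω ^ 2) μ) : Integrable (fun ω => |f ω|) μ :=
  (((memLp_two_iff_integrable_sq hm.aestronglyMeasurable).mpr hi).integrable one_le_two).abs

lemma integral_abs_le_of_sq {f : Ω → ℝ} (hm : AEMeasurable f μ)
    (hi : Integrable (fun ω => f ω ^ 2) μ) {c : ℝ} (hc : 0 ≤ c) (hle : ∫ ω, f ω ^ 2 ∂μ ≤ c ^ 2) :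
    ∫ ω, |f ω| ∂μ ≤ c := by
  have h2 : MemLp (fun ω => |f ω|) 2 μ :=
    ((memLp_two_iff_integrable_sq hm.aestronglyMeasurable).mpr hi).abs
  have h3 := variance_nonneg (fun ω => |f ω|) μ
  rw [variance_eq_sub h2] at h3
  simp only [Pi.pow_apply, sq_abs] at h3
  exact le_of_sq_le_sq (by linarith) hc

/-- Evaluating a process at an independent, uniformly distributed time averages its means. -/
lemma integral_uniform_time {T : ℕ} {τ : Ω → ℕ}
    (hτ : HasLaw τ (uniformOn (Set.Icc 1 T)) μ) {Y : ℕ → Ω → ℝ} (hY : ∀ t, Integrable (Y t) μ)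
    (hind : ∀ t, IndepFun τ (Y t) μ) :
    Integrable (fun ω => Y (τ ω) ω) μ ∧
      ∫ ω, Y (τ ω) ω ∂μ = 1 / T * ∑ t ∈ Finset.Icc 1 T, ∫ ω, Y t ω ∂μ := by
  have hmem : ∀ᵐ ω ∂μ, τ ω ∈ Set.Icc 1 T := by
    rw [hτ.ae_iff (p := fun n => n ∈ Set.Icc 1 T) (measurable_of_countable _)]
    exact ae_cond_mem measurableSet_Icc
  have hind' : ∀ t, IndepFun (fun ω => if τ ω = t then (1 : ℝ) else 0) (Y t) μ := fun t =>
    (hind t).comp (φ := fun n => if n = t then (1 : ℝ) else 0) (measurable_of_countable _)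
      measurable_id
  have hti : ∀ t, Integrable (fun ω => if τ ω = t then (1 : ℝ) else 0) μ := fun t => by
    have hm : AEMeasurable (fun ω => if τ ω = t then (1 : ℝ) else 0) μ :=
      (measurable_of_countable fun n : ℕ => if n = t then (1 : ℝ) else 0).comp_aemeasurable
        hτ.aemeasurable
    refine (integrable_const (1 : ℝ)).mono' hm.aestronglyMeasurable
      (Filter.Eventually.of_forall fun ω => ?_)
    split_ifs <;> simp
  have hprob : ∀ t ∈ Finset.Icc 1 T, ∫ ω, (if τ ω = t then (1 : ℝ) else 0) ∂μ = 1 / T :=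
    fun t ht => by
      have h1 := hτ.integral_comp (f := fun n : ℕ => if n = t then (1 : ℝ) else 0)
        (measurable_of_countable _).aestronglyMeasurable
      have h2 : (fun n : ℕ => if n = t then (1 : ℝ) else 0) = Set.indicator {t} 1 := by
        ext n; simp [Set.indicator_apply]
      have h3 : ((Finset.Icc 1 T : Finset ℕ) : Set ℕ) = Set.Icc 1 T := Finset.coe_Icc 1 T
      have h4 : (({t} : Finset ℕ) : Set ℕ) = {t} := Finset.coe_singleton t
      have h5 : Finset.Icc 1 T ∩ {t} = {t} := Finset.inter_singleton_of_mem ht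
      calc ∫ ω, (if τ ω = t then (1 : ℝ) else 0) ∂μ
          = ∫ n, (if n = t then (1 : ℝ) else 0) ∂(uniformOn (Set.Icc 1 T)) := h1
        _ = 1 / T := by
          rw [h2, integral_indicator_one (measurableSet_singleton t), measureReal_def, ← h3, ← h4,
            uniformOn_apply_finset, h5]
          simp
  have hprod : ∀ t, Integrable (fun ω => (if τ ω = t then (1 : ℝ) else 0) * Y t ω) μ := fun t =>
    (hind' t).integrable_mul (hti t) (hY t)
  have hae : ∀ᵐ ω ∂μ, ∑ t ∈ Finset.Icc 1 T, (if τ ω = t then (1 : ℝ) else 0) * Y t ω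
      = Y (τ ω) ω := by
    filter_upwards [hmem] with ω hω
    simp only [ite_mul, one_mul, zero_mul]
    rw [Finset.sum_ite_eq, if_pos (Finset.mem_Icc.mpr hω)]
  refine ⟨(integrable_finsetSum _ fun t _ => hprod t).congr hae, ?_⟩
  rw [← integral_congr_ae hae, integral_finsetSum _ fun t _ => hprod t, Finset.mul_sum]
  refine Finset.sum_congr rfl fun t ht => ?_
  have := (hind' t).integral_mul_eq_mul_integral (hti t).aestronglyMeasurable
    (hY t).aestronglyMeasurable
  simp only [Pi.mul_apply] at this
  rw [this, hprob t ht]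

end Moments

section Trajectory

variable {d m : ℕ} {Z Ξ : Type*} [MeasurableSpace Z] [MeasurableSpace Ξ] {p : Problem d m Z Ξ}
  {ρ₀ ρ₁ : ℝ} {L_F L_h : ℝ≥0} {σ_f σ_h : ℝ} {b₂ b : ℕ} {a : Params} {x₀ : E d} {u₀ : Fin m → ℝ}

lemma Problem.run_congr {w w' : ℕ → Sample m b₂ b Z Ξ} {t : ℕ} (h : ∀ i < t, w i = w' i) :
    p.run a x₀ u₀ w t = p.run a x₀ u₀ w' t := by
  induction t with
  | zero => rfl
  | succ t ih =>
    simp only [Problem.run]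
    rw [ih fun i hi => h i (by omega), h t (by omega)]

lemma Problem.Assumptions.measurable_run (A : p.Assumptions ρ₀ ρ₁ L_F L_h σ_f σ_h)
    (hh : Measurable a.hinge') {T : Type*} [MeasurableSpace T] {w : T → ℕ → Sample m b₂ b Z Ξ}
    (hw : ∀ t, Measurable fun z => w z t) (t : ℕ) :
    Measurable fun z => p.run a x₀ u₀ (w z) t := by
  induction t with
  | zero => exact measurable_const
  | succ t ih => exact A.measurable_step hh ih (hw t)

variable {Ω : Type*} [MeasurableSpace Ω] {μ : Measure Ω}
  {w : ℕ → Ω → Sample m b₂ b Z Ξ}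

lemma Problem.Assumptions.aemeasurable_run (A : p.Assumptions ρ₀ ρ₁ L_F L_h σ_f σ_h)
    (hh : Measurable a.hinge') (hw : ∀ t, AEMeasurable (w t) μ) (t : ℕ) :
    AEMeasurable (fun ω => p.run a x₀ u₀ (fun i => w i ω) t) μ := by
  have h1 : Measurable fun v : ℕ → Sample m b₂ b Z Ξ => p.run a x₀ u₀ v t :=
    A.measurable_run hh (fun i => measurable_pi_apply i) t
  exact h1.comp_aemeasurable (aemeasurable_pi_lambda _ hw)

variable [IsProbabilityMeasure μ]

/-- The state after `t` iterations depends on earlier samples only. -/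
lemma Problem.Assumptions.indepFun_run (A : p.Assumptions ρ₀ ρ₁ L_F L_h σ_f σ_h)
    (hh : Measurable a.hinge') (hw : ∀ t, AEMeasurable (w t) μ) (hind : iIndepFun w μ) (t : ℕ) :
    IndepFun (fun ω => p.run a x₀ u₀ (fun i => w i ω) t) (w t) μ := by
  obtain ⟨ω₀⟩ : Nonempty Ω := nonempty_of_isProbabilityMeasure μ
  have hdisj : Disjoint (Finset.range t) {t} := by simp
  have h := hind.indepFun_finset₀ _ _ hdisj hw
  set R : (Finset.range t → Sample m b₂ b Z Ξ) → State d m := fun v =>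
    p.run a x₀ u₀ (fun i => if hi : i ∈ Finset.range t then v ⟨i, hi⟩ else w 0 ω₀) t with hR
  have hRm : Measurable R := by
    refine A.measurable_run hh (fun i => ?_) t
    by_cases hi : i ∈ Finset.range t
    · simp only [hi, dif_pos]
      exact measurable_pi_apply _
    · simp only [hi, dif_neg, not_false_iff]
      exact measurable_const
  have hQm : Measurable fun v : (({t} : Finset ℕ) → Sample m b₂ b Z Ξ) =>
      v ⟨t, Finset.mem_singleton_self t⟩ := measurable_pi_apply _
  have h2 := h.comp hRm hQm
  have e : (R ∘ fun ω (i : Finset.range t) => w i ω)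
      = fun ω => p.run a x₀ u₀ (fun i => w i ω) t := by
    ext1 ω
    refine Problem.run_congr fun i hi => ?_
    simp [hi]
  rw [e] at h2
  exact h2

/-- A conditional one-step bound, valid at every state, passes to expectations along the
trajectory. -/
lemma Problem.Assumptions.expectation_step (A : p.Assumptions ρ₀ ρ₁ L_F L_h σ_f σ_h)
    (hh : Measurable a.hinge') (hbm : a.bc ≤ m)
    (hlaw : ∀ t, HasLaw (w t) (p.sampleLaw a.bc b₂ b) μ) (hind : iIndepFun w μ)
    {V W : State d m → ℝ} (hV : Measurable V) (hV0 : ∀ s, 0 ≤ V s)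
    (hstep : ∀ s, Integrable (fun w => V (p.step a s w)) (p.sampleLaw a.bc b₂ b) ∧
      ∫ w, V (p.step a s w) ∂p.sampleLaw a.bc b₂ b ≤ W s)
    {t : ℕ} (hW : Integrable (fun ω => W (p.run a x₀ u₀ (fun i => w i ω) t)) μ) :
    Integrable (fun ω => V (p.run a x₀ u₀ (fun i => w i ω) (t + 1))) μ ∧
      ∫ ω, V (p.run a x₀ u₀ (fun i => w i ω) (t + 1)) ∂μ
        ≤ ∫ ω, W (p.run a x₀ u₀ (fun i => w i ω) t) ∂μ := by
  have := A.probZ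
  have := A.probΞ
  have := isProbabilityMeasure_sampleLaw (p := p) (b₂ := b₂) (b := b) hbm
  have hw : ∀ t, AEMeasurable (w t) μ := fun t => (hlaw t).aemeasurable
  have hX := A.aemeasurable_run (x₀ := x₀) (u₀ := u₀) hh hw t
  have hX1 := A.aemeasurable_run (x₀ := x₀) (u₀ := u₀) hh hw (t + 1)
  have hjoint := (indepFun_iff_map_prod_eq_prod_map_map hX (hw t)).mp
    (A.indepFun_run hh hw hind t)
  rw [(hlaw t).map_eq] at hjoint
  have hW0 : ∀ s, 0 ≤ W s := fun s => (integral_nonneg fun _ => hV0 _).trans (hstep s).2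
  have hΨ : Measurable fun z : State d m × Sample m b₂ b Z Ξ =>
      ENNReal.ofReal (V (p.step a z.1 z.2)) :=
    (hV.comp (A.measurable_step hh measurable_fst measurable_snd)).ennreal_ofReal
  have hle : ∫⁻ ω, ENNReal.ofReal (V (p.run a x₀ u₀ (fun i => w i ω) (t + 1))) ∂μ
      ≤ ENNReal.ofReal (∫ ω, W (p.run a x₀ u₀ (fun i => w i ω) t) ∂μ) := by
    calc ∫⁻ ω, ENNReal.ofReal (V (p.run a x₀ u₀ (fun i => w i ω) (t + 1))) ∂μ
        = ∫⁻ z, ENNReal.ofReal (V (p.step a z.1 z.2)) ∂(Measure.map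
          (fun ω => (p.run a x₀ u₀ (fun i => w i ω) t, w t ω)) μ) :=
          (lintegral_map' hΨ.aemeasurable (hX.prodMk (hw t))).symm
      _ = ∫⁻ s, ∫⁻ v, ENNReal.ofReal (V (p.step a s v)) ∂p.sampleLaw a.bc b₂ b
          ∂(Measure.map (fun ω => p.run a x₀ u₀ (fun i => w i ω) t) μ) := by
          rw [hjoint, lintegral_prod _ hΨ.aemeasurable]
      _ = ∫⁻ ω, ∫⁻ v, ENNReal.ofReal (V (p.step a (p.run a x₀ u₀ (fun i => w i ω) t) v))
          ∂p.sampleLaw a.bc b₂ b ∂μ :=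
          lintegral_map' hΨ.lintegral_prod_right'.aemeasurable hX
      _ ≤ ∫⁻ ω, ENNReal.ofReal (W (p.run a x₀ u₀ (fun i => w i ω) t)) ∂μ := by
          refine lintegral_mono fun ω => ?_
          rw [← ofReal_integral_eq_lintegral_ofReal (hstep _).1
            (Filter.Eventually.of_forall fun _ => hV0 _)]
          exact ENNReal.ofReal_le_ofReal (hstep _).2
      _ = _ := (ofReal_integral_eq_lintegral_ofReal hW
          (Filter.Eventually.of_forall fun _ => hW0 _)).symm
  have hint : Integrable (fun ω => V (p.run a x₀ u₀ (fun i => w i ω) (t + 1))) μ := by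
    refine ⟨(hV.comp_aemeasurable hX1).aestronglyMeasurable, ?_⟩
    rw [hasFiniteIntegral_iff_ofReal (Filter.Eventually.of_forall fun _ => hV0 _)]
    exact hle.trans_lt ENNReal.ofReal_lt_top
  refine ⟨hint, ?_⟩
  rw [← ofReal_integral_eq_lintegral_ofReal hint
    (Filter.Eventually.of_forall fun _ => hV0 _)] at hle
  exact (ENNReal.ofReal_le_ofReal_iff (integral_nonneg fun _ => hW0 _)).mp hle

lemma Problem.Assumptions.expectation_move (A : p.Assumptions ρ₀ ρ₁ L_F L_h σ_f σ_h)
    (hh : ∀ z, IsSubgrad hinge z (a.hinge' z)) (hbc : 1 ≤ a.bc) (hbm : a.bc ≤ m) (hb₂ : 1 ≤ b₂)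
    (hb : 1 ≤ b) (hlaw : ∀ t, HasLaw (w t) (p.sampleLaw a.bc b₂ b) μ) (hind : iIndepFun w μ)
    (t : ℕ) :
    Integrable (fun ω => ‖(p.run a x₀ u₀ (fun i => w i ω) t).x
        - (p.run a x₀ u₀ (fun i => w i ω) t).xprev‖ ^ 2) μ ∧
      ∫ ω, ‖(p.run a x₀ u₀ (fun i => w i ω) t).x
        - (p.run a x₀ u₀ (fun i => w i ω) t).xprev‖ ^ 2 ∂μ
        ≤ a.η ^ 2 * (4 * (σ_f ^ 2 + L_F ^ 2) + 4 * d * L_h ^ 2 * a.β ^ 2) := by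
  cases t with
  | zero =>
    simp only [Problem.run, sub_self, norm_zero]
    refine ⟨integrable_const _, ?_⟩
    simp only [integral_const, probReal_univ, smul_eq_mul, one_mul]
    rw [zero_pow two_ne_zero]
    positivity
  | succ t =>
    have h := A.expectation_step (x₀ := x₀) (u₀ := u₀) (t := t)
      (monotone_of_isSubgrad_hinge hh).measurable hbm hlaw hind
      (V := fun s => ‖s.x - s.xprev‖ ^ 2)
      (W := fun _ => a.η ^ 2 * (4 * (σ_f ^ 2 + L_F ^ 2) + 4 * d * L_h ^ 2 * a.β ^ 2))
      ((measurable_state_x.sub measurable_state_xprev).norm.pow_const 2) (fun s => by positivity)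
      (fun s => A.secondMoment_move hh hbc hbm hb₂ hb s) (integrable_const _)
    simpa using h

lemma measurable_estimator_error (A : p.Assumptions ρ₀ ρ₁ L_F L_h σ_f σ_h) (k : Fin m) :
    Measurable fun s : State d m => s.u k - p.H k s.xprev :=
  (measurable_state_u k).sub ((A.lipschitz_H k).continuous.measurable.comp measurable_state_xprev)

/-- The mean square error of an estimator contracts at rate `q γ`, `q = bc / m`, towards a noise
floor. The estimator is compared with `h_k` at the previous iterate, where it was last
updated. -/
lemma Problem.Assumptions.expectation_sq_error (A : p.Assumptions ρ₀ ρ₁ L_F L_h σ_f σ_h)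
    (hh : ∀ z, IsSubgrad hinge z (a.hinge' z)) (hbc : 1 ≤ a.bc) (hbm : a.bc ≤ m) (hb₂ : 1 ≤ b₂)
    (hb : 1 ≤ b) (hγ0 : 0 < a.γ) (hγ1 : a.γ ≤ 1 / 2)
    (hlaw : ∀ t, HasLaw (w t) (p.sampleLaw a.bc b₂ b) μ) (hind : iIndepFun w μ)
    {M N : ℝ} (hM : 4 * (σ_f ^ 2 + L_F ^ 2) + 4 * d * L_h ^ 2 * a.β ^ 2 ≤ M)
    (hN : 23 / (a.bc / m) * (L_h ^ 2 * (a.η ^ 2 * M))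
      + 2 * (a.bc / m) * a.γ ^ 2 * σ_h ^ 2 / b₂ ≤ a.bc / m * a.γ * N) (k : Fin m) (t : ℕ) :
    Integrable (fun ω => ((p.run a x₀ u₀ (fun i => w i ω) t).u k
        - p.H k (p.run a x₀ u₀ (fun i => w i ω) t).xprev) ^ 2) μ ∧
      ∫ ω, ((p.run a x₀ u₀ (fun i => w i ω) t).u k
        - p.H k (p.run a x₀ u₀ (fun i => w i ω) t).xprev) ^ 2 ∂μ
        ≤ (1 - a.bc / m * a.γ) ^ t * (u₀ k - p.H k x₀) ^ 2 + N := by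
  have hc0 : (0 : ℝ) < a.bc := by positivity
  have hm0 : (0 : ℝ) < m := by exact_mod_cast hbc.trans hbm
  have hq0 : (0 : ℝ) < a.bc / m := by positivity
  have hq1 : (a.bc : ℝ) / m ≤ 1 := by
    rw [div_le_one hm0]; exact_mod_cast hbm
  have hM0 : 0 ≤ M := le_trans (by positivity) hM
  have hr : 0 ≤ 1 - a.bc / m * a.γ := by nlinarith
  induction t with
  | zero =>
    simp only [Problem.run, pow_zero, one_mul]
    refine ⟨integrable_const _, ?_⟩
    simp only [integral_const, probReal_univ, smul_eq_mul, one_mul]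
    have h0 : 0 ≤ a.bc / m * a.γ * N := le_trans (by positivity) hN
    have : 0 ≤ N := nonneg_of_mul_nonneg_right h0 (by positivity)
    linarith
  | succ t ih =>
    obtain ⟨hei, hele⟩ := ih
    obtain ⟨hvi, hvle⟩ := A.expectation_move (x₀ := x₀) (u₀ := u₀) hh hbc hbm hb₂ hb hlaw hind t
    have hvi' := (hvi.const_mul (L_h ^ 2 : ℝ)).const_mul (23 / (a.bc / m : ℝ))
    have hsum : Integrable (fun ω => (1 - a.bc / m * a.γ)
          * ((p.run a x₀ u₀ (fun i => w i ω) t).u k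
            - p.H k (p.run a x₀ u₀ (fun i => w i ω) t).xprev) ^ 2
        + 23 / (a.bc / m) * (L_h ^ 2 * ‖(p.run a x₀ u₀ (fun i => w i ω) t).x
            - (p.run a x₀ u₀ (fun i => w i ω) t).xprev‖ ^ 2)) μ := (hei.const_mul _).add hvi'
    have h := A.expectation_step (x₀ := x₀) (u₀ := u₀) (t := t)
      (monotone_of_isSubgrad_hinge hh).measurable hbm hlaw hind
      (V := fun s => (s.u k - p.H k s.xprev) ^ 2)
      (W := fun s => (1 - a.bc / m * a.γ) * (s.u k - p.H k s.xprev) ^ 2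
          + 23 / (a.bc / m) * (L_h ^ 2 * ‖s.x - s.xprev‖ ^ 2)
          + 2 * (a.bc / m) * a.γ ^ 2 * σ_h ^ 2 / b₂)
      ((measurable_estimator_error A k).pow_const 2) (fun s => by positivity)
      (fun s => A.secondMoment_estimator_step hbc hbm hb₂ hγ0.le hγ1 s k)
      (hsum.add (integrable_const _))
    refine ⟨h.1, h.2.trans ?_⟩
    rw [integral_add hsum (integrable_const _),
      integral_add (hei.const_mul _) hvi', integral_const_mul, integral_const_mul,
      integral_const_mul]
    simp only [integral_const, probReal_univ, smul_eq_mul, one_mul]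
    have h1 := mul_le_mul_of_nonneg_left hele hr
    have h2 : 23 / (a.bc / m : ℝ) * (L_h ^ 2 * ∫ ω, ‖(p.run a x₀ u₀ (fun i => w i ω) t).x
        - (p.run a x₀ u₀ (fun i => w i ω) t).xprev‖ ^ 2 ∂μ)
        ≤ 23 / (a.bc / m) * (L_h ^ 2 * (a.η ^ 2 * M)) := by
      gcongr
      exact hvle.trans (by gcongr)
    rw [pow_succ (1 - a.bc / m * a.γ : ℝ) t]
    linarith

/-- Passing from the mean square error to the mean absolute error for each constraint separately
keeps the initial error linear in the bound. -/
lemma Problem.Assumptions.expectation_abs_error (A : p.Assumptions ρ₀ ρ₁ L_F L_h σ_f σ_h)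
    (hh : ∀ z, IsSubgrad hinge z (a.hinge' z)) (hbc : 1 ≤ a.bc) (hbm : a.bc ≤ m) (hb₂ : 1 ≤ b₂)
    (hb : 1 ≤ b) (hη : 0 ≤ a.η) (hγ0 : 0 < a.γ) (hγ1 : a.γ ≤ 1 / 2)
    (hlaw : ∀ t, HasLaw (w t) (p.sampleLaw a.bc b₂ b) μ) (hind : iIndepFun w μ)
    {M n : ℝ} (hM0 : 0 ≤ M) (hn0 : 0 ≤ n)
    (hM : 4 * (σ_f ^ 2 + L_F ^ 2) + 4 * d * L_h ^ 2 * a.β ^ 2 ≤ M ^ 2)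
    (hN : 23 / (a.bc / m) * (L_h ^ 2 * (a.η ^ 2 * M ^ 2))
      + 2 * (a.bc / m) * a.γ ^ 2 * σ_h ^ 2 / b₂ ≤ a.bc / m * a.γ * n ^ 2) (k : Fin m) (t : ℕ) :
    Integrable (fun ω => |(p.run a x₀ u₀ (fun i => w i ω) t).u k
        - p.H k (p.run a x₀ u₀ (fun i => w i ω) t).x|) μ ∧
      ∫ ω, |(p.run a x₀ u₀ (fun i => w i ω) t).u k
        - p.H k (p.run a x₀ u₀ (fun i => w i ω) t).x| ∂μ
        ≤ (1 - a.bc / m * a.γ / 2) ^ t * |u₀ k - p.H k x₀| + (n + L_h * (a.η * M)) := by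
  have hc0 : (0 : ℝ) < a.bc := by positivity
  have hm0 : (0 : ℝ) < m := by exact_mod_cast hbc.trans hbm
  have hq0 : (0 : ℝ) < a.bc / m := by positivity
  have hq1 : (a.bc : ℝ) / m ≤ 1 := by
    rw [div_le_one hm0]; exact_mod_cast hbm
  have hqγ : a.bc / m * a.γ ≤ 1 := by nlinarith
  obtain ⟨hei, hele⟩ := A.expectation_sq_error (x₀ := x₀) (u₀ := u₀) hh hbc hbm hb₂ hb hγ0 hγ1
    hlaw hind hM hN k t
  obtain ⟨hvi, hvle⟩ := A.expectation_move (x₀ := x₀) (u₀ := u₀) hh hbc hbm hb₂ hb hlaw hind t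
  have hX := A.aemeasurable_run (x₀ := x₀) (u₀ := u₀) (monotone_of_isSubgrad_hinge hh).measurable
    (fun t => (hlaw t).aemeasurable) t
  have hem : AEMeasurable (fun ω => (p.run a x₀ u₀ (fun i => w i ω) t).u k
        - p.H k (p.run a x₀ u₀ (fun i => w i ω) t).xprev) μ :=
    (measurable_estimator_error A k).comp_aemeasurable hX
  have hvm : AEMeasurable (fun ω => ‖(p.run a x₀ u₀ (fun i => w i ω) t).x
        - (p.run a x₀ u₀ (fun i => w i ω) t).xprev‖) μ :=
    (measurable_state_x.sub measurable_state_xprev).norm.comp_aemeasurable hX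
  have hdm : AEMeasurable (fun ω => (p.run a x₀ u₀ (fun i => w i ω) t).u k
        - p.H k (p.run a x₀ u₀ (fun i => w i ω) t).x) μ :=
    ((measurable_state_u k).sub ((A.lipschitz_H k).continuous.measurable.comp
      measurable_state_x)).comp_aemeasurable hX
  set r := 1 - a.bc / m * a.γ / 2 with hr
  have hr0 : 0 ≤ r := by rw [hr]; linarith
  have he1 : ∫ ω, |(p.run a x₀ u₀ (fun i => w i ω) t).u k
        - p.H k (p.run a x₀ u₀ (fun i => w i ω) t).xprev| ∂μ
      ≤ r ^ t * |u₀ k - p.H k x₀| + n := by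
    refine integral_abs_le_of_sq hem hei (by positivity) (hele.trans ?_)
    have h1 : 1 - a.bc / m * a.γ ≤ r ^ 2 := by rw [hr]; nlinarith [sq_nonneg (a.bc / m * a.γ)]
    have h2 : (1 - a.bc / m * a.γ) ^ t ≤ (r ^ t) ^ 2 := by
      rw [← pow_mul, mul_comm t 2, pow_mul]
      exact pow_le_pow_left₀ (by linarith) h1 t
    have h3 := mul_le_mul_of_nonneg_right h2 (sq_nonneg (u₀ k - p.H k x₀))
    have h4 : 0 ≤ r ^ t * |u₀ k - p.H k x₀| * n := by positivity
    have h5 : (r ^ t * |u₀ k - p.H k x₀| + n) ^ 2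
        = (r ^ t) ^ 2 * (u₀ k - p.H k x₀) ^ 2 + 2 * (r ^ t * |u₀ k - p.H k x₀| * n) + n ^ 2 := by
      rw [← sq_abs (u₀ k - p.H k x₀)]; ring
    rw [h5]
    linarith
  have hv1 := integral_abs_le_of_sq hvm hvi (c := a.η * M) (by positivity)
    (hvle.trans (by rw [mul_pow]; gcongr))
  have hvint := integrable_abs_of_sq hvm hvi
  have heint := integrable_abs_of_sq hem hei
  simp only [abs_norm] at hv1 hvint
  have hub := heint.add (hvint.const_mul (L_h : ℝ))
  have hpt : ∀ ω, |(p.run a x₀ u₀ (fun i => w i ω) t).u k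
        - p.H k (p.run a x₀ u₀ (fun i => w i ω) t).x|
      ≤ |(p.run a x₀ u₀ (fun i => w i ω) t).u k
        - p.H k (p.run a x₀ u₀ (fun i => w i ω) t).xprev|
        + L_h * ‖(p.run a x₀ u₀ (fun i => w i ω) t).x
        - (p.run a x₀ u₀ (fun i => w i ω) t).xprev‖ := fun ω => by
    have h1 := (A.lipschitz_H k).norm_sub_le (p.run a x₀ u₀ (fun i => w i ω) t).x
      (p.run a x₀ u₀ (fun i => w i ω) t).xprev
    rw [norm_sub_rev, Real.norm_eq_abs] at h1
    exact (abs_sub_le _ _ _).trans (add_le_add le_rfl h1)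
  have hint : Integrable (fun ω => |(p.run a x₀ u₀ (fun i => w i ω) t).u k
        - p.H k (p.run a x₀ u₀ (fun i => w i ω) t).x|) μ :=
    hub.mono' hdm.abs.aestronglyMeasurable (Filter.Eventually.of_forall fun ω => by
      rw [Real.norm_eq_abs, abs_abs]; exact hpt ω)
  refine ⟨hint, (integral_mono hint hub hpt).trans ?_⟩
  simp only [Pi.add_apply]
  rw [integral_add heint (hvint.const_mul _), integral_const_mul]
  have h6 : (L_h : ℝ) * ∫ ω, ‖(p.run a x₀ u₀ (fun i => w i ω) t).x
        - (p.run a x₀ u₀ (fun i => w i ω) t).xprev‖ ∂μ ≤ L_h * (a.η * M) :=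
    mul_le_mul_of_nonneg_left hv1 (by positivity)
  linarith

end Trajectory

/-! ### Descent of the Moreau envelope along a trajectory -/

section Envelope

variable {d m : ℕ} {Z Ξ : Type*} [MeasurableSpace Z] [MeasurableSpace Ξ] {p : Problem d m Z Ξ}
  {ρ₀ ρ₁ : ℝ} {L_F L_h : ℝ≥0} {σ_f σ_h : ℝ} {b₂ b : ℕ} {a : Params} {x₀ : E d} {u₀ : Fin m → ℝ}

lemma measurable_norm_gradient (f : E d → ℝ) : Measurable fun x => ‖∇ f x‖ :=
  ((InnerProductSpace.toDual ℝ (E d)).symm.continuous.measurable.comp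
    (measurable_fderiv ℝ f)).norm

lemma Problem.Assumptions.exists_prox_Phi (A : p.Assumptions ρ₀ ρ₁ L_F L_h σ_f σ_h)
    (hρ₀ : 0 < ρ₀) (hρ₁ : 0 ≤ ρ₁) {β : ℝ} (hβ : 0 ≤ β) (x : E d) :
    ∃ q, IsProx (ρ₀ + ρ₁ * β) (p.Phi β) x q :=
  exists_isProx (by positivity) (A.lipschitz_Phi hβ) x

lemma Problem.Assumptions.differentiable_moreauEnv (A : p.Assumptions ρ₀ ρ₁ L_F L_h σ_f σ_h)
    (hρ₀ : 0 < ρ₀) (hρ₁ : 0 ≤ ρ₁) {β : ℝ} (hβ : 0 ≤ β) :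
    Differentiable ℝ (moreauEnv (1 / (2 * (ρ₀ + ρ₁ * β))) (p.Phi β)) := fun x => by
  obtain ⟨q, hq⟩ := A.exists_prox_Phi hρ₀ hρ₁ hβ x
  exact (hq.hasGradientAt (by positivity) (A.quadSupported_Phi hρ₁ hβ)
    (A.exists_prox_Phi hρ₀ hρ₁ hβ)).differentiableAt

lemma Problem.Assumptions.norm_gradient_moreauEnv_le
    (A : p.Assumptions ρ₀ ρ₁ L_F L_h σ_f σ_h)
    (hρ₀ : 0 < ρ₀) (hρ₁ : 0 ≤ ρ₁) {β : ℝ} (hβ : 0 ≤ β) (x : E d) :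
    ‖∇ (moreauEnv (1 / (2 * (ρ₀ + ρ₁ * β))) (p.Phi β)) x‖
      ≤ 2 * (L_F + β.toNNReal * L_h : ℝ≥0) := by
  have hρ : 0 < ρ₀ + ρ₁ * β := by positivity
  obtain ⟨q, hq⟩ := A.exists_prox_Phi hρ₀ hρ₁ hβ x
  rw [hq.norm_gradient hρ (A.quadSupported_Phi hρ₁ hβ) (A.exists_prox_Phi hρ₀ hρ₁ hβ)]
  have := hq.mul_norm_sub_le hρ (A.lipschitz_Phi hβ)
  linarith

variable {Ω : Type*} [MeasurableSpace Ω] {μ : Measure Ω} [IsProbabilityMeasure μ]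
  {w : ℕ → Ω → Sample m b₂ b Z Ξ}

lemma Problem.Assumptions.integrable_norm_gradient_pow
    (A : p.Assumptions ρ₀ ρ₁ L_F L_h σ_f σ_h) (hρ₀ : 0 < ρ₀) (hρ₁ : 0 ≤ ρ₁) {β : ℝ}
    (hβ : 0 ≤ β) {X : Ω → E d} (hX : AEMeasurable X μ) (n : ℕ) :
    Integrable (fun ω =>
      ‖∇ (moreauEnv (1 / (2 * (ρ₀ + ρ₁ * β))) (p.Phi β)) (X ω)‖ ^ n) μ := by
  refine (integrable_const ((2 * (L_F + β.toNNReal * L_h : ℝ≥0) : ℝ) ^ n)).mono'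
    (((measurable_norm_gradient _).comp_aemeasurable hX).pow_const n).aestronglyMeasurable
    (Filter.Eventually.of_forall fun ω => ?_)
  rw [Real.norm_of_nonneg (by positivity)]
  exact pow_le_pow_left₀ (norm_nonneg _) (A.norm_gradient_moreauEnv_le hρ₀ hρ₁ hβ _) n

/-- The descent inequality of the Moreau envelope, summed over the first `t` iterations. -/
lemma Problem.Assumptions.sum_gradient_le (A : p.Assumptions ρ₀ ρ₁ L_F L_h σ_f σ_h)
    (hρ₀ : 0 < ρ₀) (hρ₁ : 0 ≤ ρ₁) (hβ : 0 ≤ a.β)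
    (hh : ∀ z, IsSubgrad hinge z (a.hinge' z)) (hbc : 1 ≤ a.bc) (hbm : a.bc ≤ m) (hb₂ : 1 ≤ b₂)
    (hb : 1 ≤ b) (hη : 0 ≤ a.η) (hγ0 : 0 < a.γ) (hγ1 : a.γ ≤ 1 / 2)
    (hlaw : ∀ t, HasLaw (w t) (p.sampleLaw a.bc b₂ b) μ) (hind : iIndepFun w μ)
    {M n : ℝ} (hM0 : 0 ≤ M) (hn0 : 0 ≤ n)
    (hM : 4 * (σ_f ^ 2 + L_F ^ 2) + 4 * d * L_h ^ 2 * a.β ^ 2 ≤ M ^ 2)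
    (hN : 23 / (a.bc / m) * (L_h ^ 2 * (a.η ^ 2 * M ^ 2))
      + 2 * (a.bc / m) * a.γ ^ 2 * σ_h ^ 2 / b₂ ≤ a.bc / m * a.γ * n ^ 2)
    {C Δu : ℝ} (hC : ∀ x, C ≤ p.Phi a.β x)
    (hΔu : 1 / (m : ℝ) * ∑ k, |u₀ k - p.H k x₀| ≤ Δu) (t : ℕ) :
    Integrable (fun ω => moreauEnv (1 / (2 * (ρ₀ + ρ₁ * a.β))) (p.Phi a.β)
        (p.run a x₀ u₀ (fun i => w i ω) t).x - C) μ ∧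
      ∫ ω, (moreauEnv (1 / (2 * (ρ₀ + ρ₁ * a.β))) (p.Phi a.β)
        (p.run a x₀ u₀ (fun i => w i ω) t).x - C) ∂μ
        + a.η / 4 * ∑ j ∈ Finset.range t,
          ∫ ω, ‖∇ (moreauEnv (1 / (2 * (ρ₀ + ρ₁ * a.β))) (p.Phi a.β))
            (p.run a x₀ u₀ (fun i => w i ω) j).x‖ ^ 2 ∂μ
        ≤ moreauEnv (1 / (2 * (ρ₀ + ρ₁ * a.β))) (p.Phi a.β) x₀ - C
          + ∑ j ∈ Finset.range t, (4 * (ρ₀ + ρ₁ * a.β) * a.η * (a.β *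
              ((1 - a.bc / m * a.γ / 2) ^ j * Δu + (n + L_h * (a.η * M))))
            + (ρ₀ + ρ₁ * a.β) * a.η ^ 2 * M ^ 2) := by
  have hm0 : (0 : ℝ) < m := by exact_mod_cast hbc.trans hbm
  have hρ : 0 < ρ₀ + ρ₁ * a.β := by positivity
  have hc0 : (0 : ℝ) < a.bc := by positivity
  have hq1 : (a.bc : ℝ) / m ≤ 1 := by
    rw [div_le_one hm0]; exact_mod_cast hbm
  have hq0 : (0 : ℝ) < a.bc / m := by positivity
  have hr0 : 0 ≤ 1 - a.bc / m * a.γ / 2 := by nlinarith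
  set env := moreauEnv (1 / (2 * (ρ₀ + ρ₁ * a.β))) (p.Phi a.β) with henv
  have hcont : Continuous env := (A.differentiable_moreauEnv hρ₀ hρ₁ hβ).continuous
  induction t with
  | zero =>
    simp only [Problem.run, Finset.range_zero, Finset.sum_empty, mul_zero, add_zero]
    refine ⟨integrable_const _, ?_⟩
    simp
  | succ t ih =>
    obtain ⟨hVi, hVle⟩ := ih
    have hX := A.aemeasurable_run (x₀ := x₀) (u₀ := u₀)
      (monotone_of_isSubgrad_hinge hh).measurable (fun t => (hlaw t).aemeasurable) t
    have hgi : Integrable (fun ω => ‖∇ env (p.run a x₀ u₀ (fun i => w i ω) t).x‖ ^ 2) μ :=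
      A.integrable_norm_gradient_pow hρ₀ hρ₁ hβ (measurable_state_x.comp_aemeasurable hX) 2
    have herr := fun k => A.expectation_abs_error (x₀ := x₀) (u₀ := u₀) hh hbc hbm hb₂ hb hη hγ0
      hγ1 hlaw hind hM0 hn0 hM hN k t
    have hsi : Integrable (fun ω => a.β / m * ∑ k, |(p.run a x₀ u₀ (fun i => w i ω) t).u k
        - p.H k (p.run a x₀ u₀ (fun i => w i ω) t).x|) μ :=
      (integrable_finsetSum _ fun k _ => (herr k).1).const_mul _
    have hsle : ∫ ω, a.β / m * ∑ k, |(p.run a x₀ u₀ (fun i => w i ω) t).u k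
        - p.H k (p.run a x₀ u₀ (fun i => w i ω) t).x| ∂μ
        ≤ a.β * ((1 - a.bc / m * a.γ / 2) ^ t * Δu + (n + L_h * (a.η * M))) := by
      rw [integral_const_mul, integral_finsetSum _ fun k _ => (herr k).1]
      have h1 := Finset.sum_le_sum fun k (_ : k ∈ Finset.univ) => (herr k).2
      rw [Finset.sum_add_distrib, ← Finset.mul_sum, Finset.sum_const, Finset.card_univ,
        Fintype.card_fin, nsmul_eq_mul] at h1
      have h2 := mul_le_mul_of_nonneg_left h1 (show 0 ≤ a.β / m by positivity)
      have h3 := mul_le_mul_of_nonneg_left hΔu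
        (show 0 ≤ a.β * (1 - a.bc / m * a.γ / 2) ^ t by positivity)
      have e : a.β / m * ((1 - a.bc / m * a.γ / 2) ^ t * ∑ k, |u₀ k - p.H k x₀|
          + m * (n + L_h * (a.η * M)))
          = a.β * (1 - a.bc / m * a.γ / 2) ^ t * (1 / (m : ℝ) * ∑ k, |u₀ k - p.H k x₀|)
            + a.β * (n + L_h * (a.η * M)) := by
        field_simp
      rw [e] at h2
      linarith
    have h1i : Integrable (fun ω => env (p.run a x₀ u₀ (fun i => w i ω) t).x - C
        - a.η / 4 * ‖∇ env (p.run a x₀ u₀ (fun i => w i ω) t).x‖ ^ 2) μ :=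
      hVi.sub (hgi.const_mul _)
    have h2i : Integrable (fun ω => env (p.run a x₀ u₀ (fun i => w i ω) t).x - C
        - a.η / 4 * ‖∇ env (p.run a x₀ u₀ (fun i => w i ω) t).x‖ ^ 2
        + 4 * (ρ₀ + ρ₁ * a.β) * a.η * (a.β / m * ∑ k, |(p.run a x₀ u₀ (fun i => w i ω) t).u k
        - p.H k (p.run a x₀ u₀ (fun i => w i ω) t).x|)) μ := h1i.add (hsi.const_mul _)
    have hlow : ∀ y, C ≤ env y := fun y => by
      obtain ⟨r, hr⟩ := A.exists_prox_Phi hρ₀ hρ₁ hβ y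
      rw [henv, hr.moreauEnv_eq]
      have := hC r
      have : 0 ≤ (ρ₀ + ρ₁ * a.β) * ‖r - y‖ ^ 2 := by positivity
      linarith
    have h := A.expectation_step (x₀ := x₀) (u₀ := u₀) (t := t)
      (monotone_of_isSubgrad_hinge hh).measurable hbm hlaw hind
      (V := fun s => env s.x - C)
      (W := fun s => env s.x - C - a.η / 4 * ‖∇ env s.x‖ ^ 2
          + 4 * (ρ₀ + ρ₁ * a.β) * a.η * (a.β / m * ∑ k, |s.u k - p.H k s.x|)
          + (ρ₀ + ρ₁ * a.β) * a.η ^ 2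
            * (4 * (σ_f ^ 2 + L_F ^ 2) + 4 * d * L_h ^ 2 * a.β ^ 2))
      ((hcont.measurable.comp measurable_state_x).sub_const C)
      (fun s => sub_nonneg.mpr (hlow _))
      (fun s => A.moreauEnv_step hρ₀ hρ₁ hβ hh hbc hbm hb₂ hb hη hC s)
      (h2i.add (integrable_const _))
    refine ⟨h.1, ?_⟩
    have h3 := h.2
    rw [integral_add h2i (integrable_const _), integral_add h1i (hsi.const_mul _),
      integral_sub hVi (hgi.const_mul _), integral_const_mul (a.η / 4),
      integral_const_mul (4 * (ρ₀ + ρ₁ * a.β) * a.η)] at h3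
    simp only [integral_const, probReal_univ, smul_eq_mul, one_mul] at h3
    rw [Finset.sum_range_succ, Finset.sum_range_succ]
    have h4 := mul_le_mul_of_nonneg_left hsle
      (show 0 ≤ 4 * (ρ₀ + ρ₁ * a.β) * a.η by positivity)
    have h5 := mul_le_mul_of_nonneg_left hM
      (show 0 ≤ (ρ₀ + ρ₁ * a.β) * a.η ^ 2 by positivity)
    linarith

end Envelope

/-! ### The choice of the constants -/

lemma sum_geometric_le {r : ℝ} (h0 : 0 ≤ r) (h1 : r < 1) (n : ℕ) :
    ∑ j ∈ Finset.range n, r ^ j ≤ 1 / (1 - r) := by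
  rw [le_div_iff₀ (by linarith), geom_sum_mul_neg]
  linarith [pow_nonneg h0 n]

/-- With `τ = ε² / β²` each of the four error terms is at most a quarter of `T ε²`. -/
lemma total_error_le {q S β τ δ r ρ B K Δ Du c₃ T γ η κ G : ℝ} (hq0 : 0 < q) (hq1 : q ≤ 1)
    (hS : 1 ≤ S) (hβ : 0 < β) (hτ : 0 < τ) (hδ : 0 < δ) (hδSτ : δ * (S * τ) ≤ 1)
    (hr : 0 < r) (hρ0 : 0 < ρ) (hρ : ρ ≤ r * β) (hB : 0 ≤ B)
    (hδ1 : δ * (128 * r * B + 32 * r * K ^ 2) ≤ 1)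
    (hc₃ : 16 * |Δ| + 256 * r * |Du| ≤ δ ^ 2 * c₃)
    (hT : c₃ ≤ T * (q * S * τ ^ 3)) (hT1 : 1 ≤ T)
    (hγ : γ = δ ^ 2 / 2 * (S ^ 2 * τ ^ 2)) (hη : η = δ ^ 2 * (q * S * τ ^ 2 / β))
    (hκ : κ ≤ δ * τ * B)
    (hG : η / 4 * G ≤ Δ * β + (4 * ρ * η * (β * (2 / (q * γ) * Du + (T + 1) * κ))
      + (T + 1) * (ρ * η ^ 2 * (K * β) ^ 2))) :
    G ≤ T * (τ * β ^ 2) := by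
  have hS0 : 0 < S := by linarith
  have hη0 : 0 < η := by rw [hη]; positivity
  have hγ0 : 0 < γ := by rw [hγ]; positivity
  have hT0 : 0 < T := by linarith
  have hδT : 16 * |Δ| + 256 * r * |Du| ≤ δ ^ 2 * (T * (q * S * τ ^ 3)) :=
    hc₃.trans (mul_le_mul_of_nonneg_left hT (sq_nonneg δ))
  have hDu0 : 0 ≤ 256 * r * |Du| := by positivity
  -- the initial suboptimality
  have t1 : 4 * Δ * β / η ≤ T * (τ * β ^ 2) / 4 := by
    rw [div_le_iff₀ hη0, hη]
    have h1 : 16 * Δ ≤ δ ^ 2 * (T * (q * S * τ ^ 3)) := by linarith [le_abs_self Δ]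
    calc 4 * Δ * β = β / 4 * (16 * Δ) := by ring
      _ ≤ β / 4 * (δ ^ 2 * (T * (q * S * τ ^ 3))) := by gcongr
      _ = _ := by field_simp
  -- the initial error of the estimators
  have t2 : 16 * ρ * β * (2 / (q * γ) * Du) ≤ T * (τ * β ^ 2) / 4 := by
    have h1 : 256 * r * |Du| ≤ δ ^ 2 * (T * (q * S ^ 2 * τ ^ 3)) := by
      have : δ ^ 2 * (T * (q * S * τ ^ 3)) ≤ δ ^ 2 * (T * (q * S ^ 2 * τ ^ 3)) := by
        gcongr
        nlinarith
      linarith [abs_nonneg Δ]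
    calc 16 * ρ * β * (2 / (q * γ) * Du) ≤ 16 * (r * β) * β * (2 / (q * γ) * |Du|) := by
          have h2 : 2 / (q * γ) * Du ≤ 2 / (q * γ) * |Du| :=
            mul_le_mul_of_nonneg_left (le_abs_self Du) (by positivity)
          exact (mul_le_mul_of_nonneg_left h2 (by positivity)).trans (by gcongr)
      _ = β ^ 2 / (4 * (q * (δ ^ 2 * (S ^ 2 * τ ^ 2)))) * (256 * r * |Du|) := by
          rw [hγ]
          field_simp
          ring
      _ ≤ β ^ 2 / (4 * (q * (δ ^ 2 * (S ^ 2 * τ ^ 2))))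
          * (δ ^ 2 * (T * (q * S ^ 2 * τ ^ 3))) := by gcongr
      _ = _ := by field_simp
  have hT2 : T + 1 ≤ 2 * T := by linarith
  have hK0 : 0 ≤ 32 * r * K ^ 2 := by positivity
  have hB0 : 0 ≤ 128 * r * B := by positivity
  -- the noise floor of the estimators
  have t3 : 16 * ρ * β * ((T + 1) * κ) ≤ T * (τ * β ^ 2) / 4 := by
    have h1 : δ * (128 * r * B) ≤ 1 :=
      (mul_le_mul_of_nonneg_left (by linarith) hδ.le).trans hδ1
    calc 16 * ρ * β * ((T + 1) * κ) ≤ 16 * (r * β) * β * ((2 * T) * (δ * τ * B)) := by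
          have : (T + 1) * κ ≤ 2 * T * (δ * τ * B) :=
            (mul_le_mul_of_nonneg_left hκ (by linarith)).trans
              (mul_le_mul_of_nonneg_right hT2 (by positivity))
          have h2 : 16 * ρ * β * ((T + 1) * κ) ≤ 16 * ρ * β * (2 * T * (δ * τ * B)) :=
            mul_le_mul_of_nonneg_left this (by positivity)
          exact h2.trans (by gcongr)
      _ = T * (τ * β ^ 2) / 4 * (δ * (128 * r * B)) := by ring
      _ ≤ T * (τ * β ^ 2) / 4 * 1 := by gcongr
      _ = _ := mul_one _
  -- the variance of the directions
  have t4 : 4 * ((T + 1) * (ρ * η * (K * β) ^ 2)) ≤ T * (τ * β ^ 2) / 4 := by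
    have h1 : δ * (32 * r * K ^ 2) ≤ 1 :=
      (mul_le_mul_of_nonneg_left (by linarith) hδ.le).trans hδ1
    have h2 : η ≤ δ * τ / β := by
      have : δ * (S * τ) * q ≤ 1 := mul_le_one₀ hδSτ hq0.le hq1
      rw [hη]
      calc δ ^ 2 * (q * S * τ ^ 2 / β) = δ * τ / β * (δ * (S * τ) * q) := by ring
        _ ≤ δ * τ / β * 1 := by gcongr
        _ = _ := mul_one _
    calc 4 * ((T + 1) * (ρ * η * (K * β) ^ 2))
        ≤ 4 * ((2 * T) * (r * β * (δ * τ / β) * (K * β) ^ 2)) := by gcongr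
      _ = T * (τ * β ^ 2) / 4 * (δ * (32 * r * K ^ 2)) := by field_simp; ring
      _ ≤ T * (τ * β ^ 2) / 4 * 1 := by gcongr
      _ = _ := mul_one _
  have hG' : G ≤ 4 * Δ * β / η + 16 * ρ * β * (2 / (q * γ) * Du) + 16 * ρ * β * ((T + 1) * κ)
      + 4 * ((T + 1) * (ρ * η * (K * β) ^ 2)) := by
    have h1 := mul_le_mul_of_nonneg_left hG (show 0 ≤ 4 / η by positivity)
    have e1 : 4 / η * (η / 4 * G) = G := by field_simp
    rw [e1] at h1
    refine h1.trans (le_of_eq ?_)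
    field_simp
    ring
  linarith

/-- The noise floor of the mean absolute error of the estimators is of order `δ τ`. The factor is at
least `1`, hence bounded by its square, which dominates the sum of the two noise terms. -/
lemma noise_floor_le {q S β τ δ L K σ γ η : ℝ} (hq0 : 0 < q) (hS : 1 ≤ S) (hβ : 0 < β)
    (hγ : γ = δ ^ 2 / 2 * (S ^ 2 * τ ^ 2)) (hη : η = δ ^ 2 * (q * S * τ ^ 2 / β)) :
    23 / q * (L ^ 2 * (η ^ 2 * (K * β) ^ 2)) + 2 * q * γ ^ 2 * σ ^ 2 / S ^ 2
      ≤ q * γ * (δ * (46 * L ^ 2 * K ^ 2 + σ ^ 2 + 1) * τ) ^ 2 := by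
  have hS0 : 0 < S := by linarith
  set A := 46 * L ^ 2 * K ^ 2 + σ ^ 2 + 1 with hA
  have hA1 : 1 ≤ A := by
    have : 0 ≤ 46 * L ^ 2 * K ^ 2 + σ ^ 2 := by positivity
    linarith
  have e : 23 / q * (L ^ 2 * (η ^ 2 * (K * β) ^ 2)) + 2 * q * γ ^ 2 * σ ^ 2 / S ^ 2
      = q * δ ^ 4 * S ^ 2 * τ ^ 4 / 2 * (46 * L ^ 2 * K ^ 2 + σ ^ 2) := by
    rw [hγ, hη]
    field_simp
    ring
  have e2 : q * γ * (δ * A * τ) ^ 2 = q * δ ^ 4 * S ^ 2 * τ ^ 4 / 2 * A ^ 2 := by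
    rw [hγ]
    ring
  rw [e, e2]
  refine mul_le_mul_of_nonneg_left ?_ (by positivity)
  nlinarith

end HingePenalty

open HingePenalty
theorem theorem2 (d : ℕ) (ρ₀ ρ₁ : ℝ) (hρ₀ : 0 < ρ₀) (hρ₁ : 0 < ρ₁) (L_F L_h : ℝ≥0)
    (σ_f σ_h β₀ Δ Δu : ℝ) (hβ₀ : 0 < β₀) :
    ∃ c₁ c₂ c₃ : ℝ, 0 < c₁ ∧ c₁ ≤ 1 / 2 ∧ 0 < c₂ ∧ 0 < c₃ ∧
      ∀ (m bc b₂ b : ℕ), 1 ≤ bc → bc ≤ m → 1 ≤ b₂ → 1 ≤ b →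
      ∀ (Z Ξ : Type*) [MeasurableSpace Z] [MeasurableSpace Ξ] (p : Problem d m Z Ξ),
        p.Assumptions ρ₀ ρ₁ L_F L_h σ_f σ_h →
      ∀ (β ε : ℝ), β₀ ≤ β → 0 < ε →
      ∀ (x₀ : E d) (u₀ : Fin m → ℝ),
        (∀ x, p.Phi β x₀ - p.Phi β x ≤ Δ * β) →
        (1 / (m : ℝ) * ∑ k, |u₀ k - p.H k x₀| ≤ Δu) →
      ∀ hinge' : ℝ → ℝ, (∀ z, IsSubgrad hinge z (hinge' z)) →
      ∀ (γ η θ : ℝ) (T : ℕ),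
        γ = c₁ * (b₂ * ε ^ 4 / β ^ 4) → γ ≤ 1 / 2 →
        η = c₂ * (bc * √(b₂ : ℝ) * ε ^ 4 / (β ^ 5 * m)) →
        c₃ * (β ^ 6 * m / (bc * √(b₂ : ℝ) * ε ^ 6)) ≤ T →
        θ = 1 / (2 * (ρ₀ + ρ₁ * β)) →
      ∀ (Ω : Type*) [MeasurableSpace Ω] (μ : Measure Ω) [IsProbabilityMeasure μ]
        (w : ℕ → Ω → Sample m b₂ b Z Ξ) (that : Ω → ℕ),
        iIndepFun w μ → (∀ t, HasLaw (w t) (p.sampleLaw bc b₂ b) μ) →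
        HasLaw that (uniformOn (Set.Icc 1 T)) μ →
        IndepFun that (fun ω t => w t ω) μ →
        Differentiable ℝ (moreauEnv θ (p.Phi β)) ∧
        Integrable (fun ω => ‖∇ (moreauEnv θ (p.Phi β))
          (p.run ⟨β, γ, η, bc, hinge'⟩ x₀ u₀ (fun t => w t ω) (that ω)).x‖) μ ∧
        ∫ ω, ‖∇ (moreauEnv θ (p.Phi β))
          (p.run ⟨β, γ, η, bc, hinge'⟩ x₀ u₀ (fun t => w t ω) (that ω)).x‖ ∂μ ≤ ε := by
  -- `r` and `K` bound `(ρ₀ + ρ₁ β) / β` and the root mean square of the direction over `β`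
  obtain ⟨r, hr⟩ : ∃ r, r = ρ₀ / β₀ + ρ₁ := ⟨_, rfl⟩
  obtain ⟨K, hK⟩ : ∃ K : ℝ,
    K = 4 * (σ_f ^ 2 + L_F ^ 2) / β₀ ^ 2 + 4 * d * L_h ^ 2 + 1 := ⟨_, rfl⟩
  -- `δ A₀ τ` is the noise floor of the estimators, and `δ B τ` includes the last move of the iterate
  obtain ⟨A₀, hA₀⟩ : ∃ A₀ : ℝ, A₀ = 46 * L_h ^ 2 * K ^ 2 + σ_h ^ 2 + 1 := ⟨_, rfl⟩
  obtain ⟨B, hB⟩ : ∃ B : ℝ, B = A₀ + L_h * K := ⟨_, rfl⟩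
  obtain ⟨δ, hδ⟩ : ∃ δ : ℝ, δ = 1 / (1 + (128 * r * B + 32 * r * K ^ 2)) := ⟨_, rfl⟩
  have hr0 : 0 < r := by rw [hr]; positivity
  have hK1 : 1 ≤ K := by
    have : 0 ≤ 4 * (σ_f ^ 2 + (L_F : ℝ) ^ 2) / β₀ ^ 2 + 4 * d * L_h ^ 2 := by positivity
    linarith
  have hA0 : 0 ≤ A₀ := by rw [hA₀]; positivity
  have hB0 : 0 ≤ B := by rw [hB]; positivity
  have hδ0 : 0 < δ := by rw [hδ]; positivity
  have hden : 0 ≤ 128 * r * B + 32 * r * K ^ 2 := by positivity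
  have hδ1 : δ ≤ 1 := by
    rw [hδ, div_le_one (by positivity)]
    linarith
  have hδ2 : δ * (128 * r * B + 32 * r * K ^ 2) ≤ 1 := by
    rw [hδ, one_div_mul_eq_div, div_le_one (by positivity)]
    linarith
  refine ⟨δ ^ 2 / 2, δ ^ 2, (16 * |Δ| + 256 * r * |Δu|) / δ ^ 2 + 1, by positivity, ?_,
    by positivity, by positivity, ?_⟩
  · have : δ ^ 2 ≤ 1 := pow_le_one₀ hδ0.le hδ1
    linarith
  intro m bc b₂ b hbc hbm hb₂ hb Z Ξ _ _ p A β ε hβ hε x₀ u₀ hΔ hΔu hinge' hh γ η θ T hγ hγ1 hη hT hθ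
    Ω _ μ _ w that hind hlaw hthat hindt
  subst hθ
  have hβ0 : 0 < β := hβ₀.trans_le hβ
  have hm0 : (0 : ℝ) < m := by exact_mod_cast hbc.trans hbm
  have hc0 : (0 : ℝ) < bc := by exact_mod_cast hbc
  -- the scale-free parameters `q = bc / m`, `S = √b₂` and `τ = ε² / β²`
  obtain ⟨q, hq⟩ : ∃ q : ℝ, q = bc / m := ⟨_, rfl⟩
  obtain ⟨S, hS⟩ : ∃ S : ℝ, S = √(b₂ : ℝ) := ⟨_, rfl⟩
  obtain ⟨τ, hτ⟩ : ∃ τ : ℝ, τ = ε ^ 2 / β ^ 2 := ⟨_, rfl⟩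
  have hq0 : 0 < q := by rw [hq]; positivity
  have hq1 : q ≤ 1 := by rw [hq, div_le_one hm0]; exact_mod_cast hbm
  have hS1 : 1 ≤ S := by
    rw [hS, Real.one_le_sqrt]
    exact_mod_cast hb₂
  have hS2 : S ^ 2 = b₂ := by rw [hS, Real.sq_sqrt (by positivity)]
  have hτ0 : 0 < τ := by rw [hτ]; positivity
  have hγ' : γ = δ ^ 2 / 2 * (S ^ 2 * τ ^ 2) := by
    rw [hγ, hS2, hτ]
    field_simp
  have hη' : η = δ ^ 2 * (q * S * τ ^ 2 / β) := by
    rw [hη, ← hS, hq, hτ]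
    field_simp
  have hS0 : 0 < S := by linarith
  have hγ0 : 0 < γ := by rw [hγ']; positivity
  have hη0 : 0 < η := by rw [hη']; positivity
  have hδSτ : δ * (S * τ) ≤ 1 := by
    have h1 : (δ * (S * τ)) ^ 2 ≤ 1 ^ 2 := by
      have : (δ * (S * τ)) ^ 2 = 2 * γ := by rw [hγ']; ring
      rw [this]
      linarith
    exact le_of_sq_le_sq h1 zero_le_one
  have hT' : (16 * |Δ| + 256 * r * |Δu|) / δ ^ 2 + 1 ≤ T * (q * S * τ ^ 3) := by
    have e : β ^ 6 * m / (bc * S * ε ^ 6) = 1 / (q * S * τ ^ 3) := by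
      rw [hq, hτ]
      field_simp
    rw [← hS, e, mul_one_div, div_le_iff₀ (by positivity)] at hT
    exact hT
  have hT1 : (1 : ℝ) ≤ T := by
    have h1 : 0 ≤ (16 * |Δ| + 256 * r * |Δu|) / δ ^ 2 := by positivity
    have h2 : (0 : ℝ) < T := by
      by_contra! h
      have : (T : ℝ) * (q * S * τ ^ 3) ≤ 0 := mul_nonpos_of_nonpos_of_nonneg h (by positivity)
      linarith
    exact_mod_cast (by exact_mod_cast h2 : 0 < T)
  have hM : 4 * (σ_f ^ 2 + (L_F : ℝ) ^ 2) + 4 * d * L_h ^ 2 * β ^ 2 ≤ (K * β) ^ 2 := by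
    have h1 : 4 * (σ_f ^ 2 + (L_F : ℝ) ^ 2)
        ≤ 4 * (σ_f ^ 2 + (L_F : ℝ) ^ 2) / β₀ ^ 2 * β ^ 2 := by
      rw [div_mul_eq_mul_div, le_div_iff₀ (by positivity)]
      gcongr
    have h2 : K * β ^ 2 ≤ (K * β) ^ 2 := by
      rw [mul_pow]
      exact mul_le_mul_of_nonneg_right (le_self_pow₀ hK1 two_ne_zero) (sq_nonneg β)
    have h3 : K * β ^ 2 = 4 * (σ_f ^ 2 + (L_F : ℝ) ^ 2) / β₀ ^ 2 * β ^ 2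
        + 4 * d * L_h ^ 2 * β ^ 2 + β ^ 2 := by rw [hK]; ring
    have h4 : 0 ≤ β ^ 2 := sq_nonneg β
    linarith
  have hN := noise_floor_le (L := (L_h : ℝ)) (K := K) (σ := σ_h) hq0 hS1 hβ0 hγ' hη'
  rw [← hA₀, hS2, hq] at hN
  have hC : ∀ x, p.Phi β x₀ - Δ * β ≤ p.Phi β x := fun x => by linarith [hΔ x]
  have hdesc := A.sum_gradient_le (a := ⟨β, γ, η, bc, hinge'⟩) (x₀ := x₀) hρ₀ hρ₁.le hβ0.le hh
    hbc hbm hb₂ hb hη0.le hγ0 hγ1 hlaw hind (M := K * β) (n := δ * A₀ * τ) (by positivity)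
    (by positivity) hM hN hC hΔu (T + 1)
  dsimp only at hdesc
  rw [← hq] at hdesc
  obtain ⟨-, hdesc⟩ := hdesc
  obtain ⟨κ, hκ⟩ : ∃ κ : ℝ, κ = δ * A₀ * τ + L_h * (η * (K * β)) := ⟨_, rfl⟩
  have hρ : 0 < ρ₀ + ρ₁ * β := by positivity
  set env := moreauEnv (1 / (2 * (ρ₀ + ρ₁ * β))) (p.Phi β) with henv
  set X : ℕ → Ω → State d m := fun t ω =>
    p.run ⟨β, γ, η, bc, hinge'⟩ x₀ u₀ (fun i => w i ω) t with hXdef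
  have hDu : 0 ≤ Δu := le_trans (by positivity) hΔu
  have hlow : 0 ≤ ∫ ω, (env (X (T + 1) ω).x - (p.Phi β x₀ - Δ * β)) ∂μ :=
    integral_nonneg fun ω => by
      obtain ⟨s, hs⟩ := A.exists_prox_Phi hρ₀ hρ₁.le hβ0.le (X (T + 1) ω).x
      have h1 := hC s
      have h2 : 0 ≤ (ρ₀ + ρ₁ * β) * ‖s - (X (T + 1) ω).x‖ ^ 2 := by positivity
      change 0 ≤ env (X (T + 1) ω).x - (p.Phi β x₀ - Δ * β)
      rw [henv, hs.moreauEnv_eq]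
      linarith
  have hinit : env x₀ - (p.Phi β x₀ - Δ * β) ≤ Δ * β := by
    obtain ⟨s, hs⟩ := A.exists_prox_Phi hρ₀ hρ₁.le hβ0.le x₀
    have h1 := hs.moreauEnv_le x₀
    rw [sub_self, norm_zero] at h1
    rw [henv]
    linarith
  have hgeom : ∑ j ∈ Finset.range (T + 1), (1 - q * γ / 2) ^ j ≤ 2 / (q * γ) := by
    have h1 : 0 < q * γ := by positivity
    have h2 : q * γ ≤ 1 := mul_le_one₀ hq1 hγ0.le (by linarith)
    refine (sum_geometric_le (by linarith) (by linarith) _).trans (le_of_eq ?_)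
    field_simp
    ring
  have hsum : ∑ j ∈ Finset.range (T + 1), (4 * (ρ₀ + ρ₁ * β) * η * (β *
        ((1 - q * γ / 2) ^ j * Δu + κ)) + (ρ₀ + ρ₁ * β) * η ^ 2 * (K * β) ^ 2)
      ≤ 4 * (ρ₀ + ρ₁ * β) * η * (β * (2 / (q * γ) * Δu + (T + 1) * κ))
        + (T + 1) * ((ρ₀ + ρ₁ * β) * η ^ 2 * (K * β) ^ 2) := by
    rw [Finset.sum_add_distrib, ← Finset.mul_sum, ← Finset.mul_sum, Finset.sum_add_distrib,
      ← Finset.sum_mul, Finset.sum_const, Finset.sum_const, Finset.card_range, nsmul_eq_mul,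
      nsmul_eq_mul]
    push_cast
    gcongr
  have hG := total_error_le (G := ∑ j ∈ Finset.range (T + 1), ∫ ω, ‖∇ env (X j ω).x‖ ^ 2 ∂μ)
    (ρ := ρ₀ + ρ₁ * β) (B := B) (K := K) (Δ := Δ) (Du := Δu) (κ := κ) hq0 hq1 hS1 hβ0 hτ0 hδ0
    hδSτ hr0 hρ (by
      rw [hr, add_mul, div_mul_eq_mul_div]
      gcongr
      rw [le_div_iff₀ hβ₀]
      gcongr) hB0 hδ2 (by
      rw [mul_add, mul_div_cancel₀ _ (by positivity)]
      have : 0 ≤ δ ^ 2 * 1 := by positivity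
      linarith) hT' hT1 hγ' hη' (by
      have h1 : η * (K * β) ≤ δ * τ * K := by
        have h2 : η * β = δ * τ * (δ * (S * τ) * q) := by rw [hη']; field_simp
        have h3 : δ * (S * τ) * q ≤ 1 := mul_le_one₀ hδSτ hq0.le hq1
        calc η * (K * β) = η * β * K := by ring
          _ = δ * τ * K * (δ * (S * τ) * q) := by rw [h2]; ring
          _ ≤ δ * τ * K * 1 := by gcongr
          _ = _ := mul_one _
      have h4 : (L_h : ℝ) * (η * (K * β)) ≤ L_h * (δ * τ * K) :=
        mul_le_mul_of_nonneg_left h1 L_h.2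
      rw [hκ, hB]
      linarith) (by
      rw [← hκ] at hdesc
      linarith)
  have hw : ∀ t, AEMeasurable (w t) μ := fun t => (hlaw t).aemeasurable
  have hhm := (monotone_of_isSubgrad_hinge hh).measurable
  have hXm : ∀ t, AEMeasurable (fun ω => (X t ω).x) μ := fun t =>
    measurable_state_x.comp_aemeasurable
      (A.aemeasurable_run (a := ⟨β, γ, η, bc, hinge'⟩) hhm hw t)
  have hgi : ∀ n t, Integrable (fun ω => ‖∇ env (X t ω).x‖ ^ n) μ := fun n t =>
    A.integrable_norm_gradient_pow hρ₀ hρ₁.le hβ0.le (hXm t) n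
  have hgind : ∀ n t, IndepFun that (fun ω => ‖∇ env (X t ω).x‖ ^ n) μ := fun n t => by
    have h1 : Measurable fun v : ℕ → Sample m b₂ b Z Ξ =>
        (p.run ⟨β, γ, η, bc, hinge'⟩ x₀ u₀ v t).x :=
      measurable_state_x.comp (A.measurable_run (a := ⟨β, γ, η, bc, hinge'⟩) hhm
        (fun i => measurable_pi_apply i) t)
    exact hindt.comp measurable_id (((measurable_norm_gradient env).comp h1).pow_const n)
  obtain ⟨hi1, -⟩ := integral_uniform_time hthat (hgi 1) (hgind 1)
  obtain ⟨hi2, hI2⟩ := integral_uniform_time hthat (hgi 2) (hgind 2)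
  simp only [pow_one] at hi1
  refine ⟨A.differentiable_moreauEnv hρ₀ hρ₁.le hβ0.le, hi1, ?_⟩
  have hsq : ∫ ω, ‖∇ env (X (that ω) ω).x‖ ^ 2 ∂μ ≤ ε ^ 2 := by
    have hsub : Finset.Icc 1 T ⊆ Finset.range (T + 1) := fun t ht => by
      rw [Finset.mem_Icc] at ht
      exact Finset.mem_range.mpr (by omega)
    have h1 := Finset.sum_le_sum_of_subset_of_nonneg hsub
      (f := fun j => ∫ ω, ‖∇ env (X j ω).x‖ ^ 2 ∂μ)
      fun j _ _ => integral_nonneg fun ω => by positivity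
    rw [hI2, one_div_mul_eq_div, div_le_iff₀ (by linarith)]
    refine (h1.trans hG).trans (le_of_eq ?_)
    rw [hτ]
    field_simp
  have := integral_abs_le_of_sq hi1.aemeasurable hi2 hε.le hsq
  simpa only [abs_norm] using this
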